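/- For $0\le k\le n$ let $\binom{[n]}{k}=\{x\in\{0,1\}^n : |x|=k\}$ be the $k$-th slice of the Boolean hypercube ($|x|$ is the Hamming weight), and let $\mu_k:\{0,1\}^n\to[0,\infty)$ be the uniform probability measure on it. For $\mathcal S\subseteq\binom{[n]}{k}$ put $\mu_{\mathcal S}(x)=\mu_k(x)\,1_{x\in\mathcal S}$. For weight functions $w_U,w_V:\{0,1\}^n\to[0,\infty)$ of equal total mass, with supports $U,V$, write $w_U\lesssim w_V$ (there is a monotone fractional matching from $w_U$ to $w_V$) if there is $w:U\times V\to[0,\infty)$ such that $w(u,v)>0$ only when $u\le v$ coordinatewise, $\sum_{z\in V}w(x,z)=w_U(x)$ for all $x\in U$, and $\sum_{z\in U}w(z,y)=w_V(y)$ for all $y\in V$. **Lemma.** There is an absolute constant $c>0$ such that for every $C>0$ there is $n_0\in\mathbb N$ such that the following holds for all $n\ge n_0$. Let $k,s,t\in\mathbb N$ satisfy $\frac n2-C\sqrt{n\log n}\le k\le \frac n2+C\sqrt{n\log n}$, $10n^{1/3}\le t\le C\sqrt{n\log n}$ and $0\le s\le\binom nk$, and put $\rho=s/\binom nk$. Then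 $t\le k$ and $k+t\le n$, and for a uniformly random $\mathcal S\subseteq\binom{[n]}{k}$ of size $s$, $$\Pr_{\mathcal S}\big[(t+\rho)\mu_{k-t}\lesssim t\mu_k+\mu_{\mathcal S}\big]\ \ge\ 1-2^{-c\,2^{n/2}}$$ and $$\Pr_{\mathcal S}\big[t\mu_k+\mu_{\mathcal S}\lesssim (t+\rho)\mu_{k+t}\big]\ \ge\ 1-2^{-c\,2^{n/2}}.$$ -/

import Mathlib

open Finset
open scoped NNReal

/-- The Boolean hypercube `{0,1}^n`: a vector is identified with the set of its coordinates
equal to `1`, so the pointwise order is inclusion and the Hamming weight is the cardinality. -/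
abbrev Cube (n : ℕ) : Type := Finset (Fin n)

/-- The slice of all points of Hamming weight `k`. -/
def cubeSlice (n k : ℕ) : Finset (Cube n) := powersetCard k univ

/-- The uniform probability measure `μ_k` on the slice of weight `k`, as a weight function on the
whole cube. -/
noncomputable def sliceMeasure (n k : ℕ) : Cube n → ℝ≥0 :=
  fun x => if x ∈ cubeSlice n k then ((#(cubeSlice n k) : ℕ) : ℝ≥0)⁻¹ else 0

/-- `μ_S(x) = μ_k(x) 1_{x ∈ S}` for a collection `S` in the slice of weight `k`
(a measure of total mass `|S| / binom(n,k)`). -/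
noncomputable def subsetMeasure (n k : ℕ) (S : Finset (Cube n)) : Cube n → ℝ≥0 :=
  fun x => if x ∈ S then sliceMeasure n k x else 0

/-- The support of a weight function on the cube. -/
noncomputable def weightSupport {n : ℕ} (f : Cube n → ℝ≥0) : Finset (Cube n) :=
  univ.filter fun x => f x ≠ 0

/-- There is a monotone fractional matching from `wU` to `wV` (two weight functions of equal total
mass). Only the values of `w` on the product of the two supports are used. -/
def MonotoneFractionalMatching {n : ℕ} (wU wV : Cube n → ℝ≥0) : Prop :=
  ∑ x, wU x = ∑ x, wV x ∧
  ∃ w : Cube n → Cube n → ℝ≥0,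
    (∀ u ∈ weightSupport wU, ∀ v ∈ weightSupport wV, 0 < w u v → u ≤ v) ∧
    (∀ x ∈ weightSupport wU, ∑ z ∈ weightSupport wV, w x z = wU x) ∧
    (∀ y ∈ weightSupport wV, ∑ z ∈ weightSupport wU, w z y = wV y)

/-- The probability that a uniformly random `s`-element subset `S` of the slice of weight `k`
satisfies `P`. -/
noncomputable def randomSubsetProb (n k s : ℕ) (P : Finset (Cube n) → Prop) : ℝ :=
  open Classical in
  (#((powersetCard s (cubeSlice n k)).filter P) : ℝ) / (#(powersetCard s (cubeSlice n k)) : ℝ)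

/-! Complementing all points turns the second matching into the first one on the slice of weight `n
- k`, so only the lower slice has to be treated. By Hall's theorem a matching exists if every family
`E` of weight `k - t`, with `t`-fold upper shadow `D`, satisfies `(t + ρ) e ≤ t d + |S ∩ D| / N`,
where `e`, `d` are densities and `N = n.choose k`. If `D` fills more than half of its slice, one
passes to its complement `B`, whose `t`-fold lower shadow is disjoint from `E`, and proves `t b + |S
∩ B| / N ≤ (t + ρ) a` with `a` the density of that shadow.

Let `v ≤ 1/2` be the density in slice `k` and `L = -log v`. Keevash's form of Kruskal–Katona
(`card_le_of_shadow_subset`) gives a relative gain of order `L / n` per level. If the total gain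
over `t` levels reaches the factor `1 + 1/t`, Hall's condition holds for every `S`. Otherwise
`gap_of_chain` yields `L < 4n / t²` together with a slack of at least `t² L v / (8n)`. It then
suffices that `S` has nearly the expected size on `B` or `D`.

Chernoff's bound for one set of size `m` costs about `exp(-θ² m)` with `θ = t² L / (64n)`, which is
too weak for a union bound over all such sets. The small gain helps: the bipartite graph between the
set and its shadow in the next slice is then nearly biregular, so about `q m` greedily chosen points
dominate most of one side and determine a container close to the set (`exists_shadow_approx`,
`exists_upShadow_approx`). With `q = n^(-5/6)` the number of containers is less than `exp(θ² m)`,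
because `θ² ≥ n^(-2/3)`. The relevant `m` are at least `N exp(-n^(1/3) / 25)`, so the failure
probability is doubly exponentially small. -/

/-! ### Kruskal–Katona in Keevash's form -/

/-- The generalized binomial coefficient `x (x-1) ⋯ (x-l+1) / l!`. -/
noncomputable def realChoose : ℕ → ℝ → ℝ
  | 0, _ => 1
  | l + 1, x => x / (l + 1) * realChoose l (x - 1)

theorem sum_card_memberSubfamily {α : Type*} [Fintype α] [DecidableEq α] {l : ℕ}
    {A : Finset (Finset α)} (hA : (A : Set (Finset α)).Sized l) :
    ∑ v, #(A.memberSubfamily v) = l * #A := by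
  have h1 : ∀ v, #(A.memberSubfamily v) = #(A.filter (v ∈ ·)) := by
    intro v
    rw [memberSubfamily, card_image_of_injOn]
    intro s hs t ht h
    simp only [coe_filter, Set.mem_ofPred_eq] at hs ht
    exact erase_injOn' v hs.2 ht.2 h
  simp_rw [h1, card_filter]
  rw [sum_comm]
  have h2 : ∀ s ∈ A, ∑ v, (if v ∈ s then 1 else 0) = l := by
    intro s hs
    simp [hA hs]
  rw [sum_congr rfl h2]
  simp [mul_comm]

theorem memberSubfamily_shadow_subset {α : Type*} [DecidableEq α] {A B : Finset (Finset α)}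
    (hBA : ∀ b ∈ B, ∀ v ∈ b, b.erase v ∈ A) (v : α) :
    ∀ b ∈ B.memberSubfamily v, ∀ w ∈ b, b.erase w ∈ A.memberSubfamily v := by
  intro b hb w hw
  rw [mem_memberSubfamily] at hb ⊢
  have hne : v ≠ w := fun h => hb.2 (h ▸ hw)
  refine ⟨?_, fun h => hb.2 (mem_of_mem_erase h)⟩
  rw [← erase_insert_of_ne hne]
  exact hBA _ hb.1 w (mem_insert_of_mem hw)

theorem sized_memberSubfamily {α : Type*} [DecidableEq α] {l : ℕ} {A : Finset (Finset α)}
    (hA : (A : Set (Finset α)).Sized (l + 1)) (v : α) :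
    (A.memberSubfamily v : Set (Finset α)).Sized l := by
  intro s hs
  have hs' := mem_memberSubfamily.1 (mem_coe.1 hs)
  have h := hA hs'.1
  rw [card_insert_of_notMem hs'.2] at h
  omega

/-- The averaging step over links in Keevash's proof. -/
theorem card_le_of_link_bound {α : Type*} [Fintype α] [DecidableEq α] {l : ℕ} {x : ℝ}
    {A B : Finset (Finset α)}
    (hA : (A : Set (Finset α)).Sized (l + 1)) (hB : (B : Set (Finset α)).Sized (l + 2))
    (hBA : ∀ b ∈ B, ∀ v ∈ b, b.erase v ∈ A)
    (hlink : ∀ v, 0 < #(A.memberSubfamily v) →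
      (#(A.memberSubfamily v) : ℝ) * x < (l + 1) * #A →
      ((l : ℝ) + 1) * #(B.memberSubfamily v) ≤ (x - (l + 1)) * #(A.memberSubfamily v)) :
    ((l : ℝ) + 2) * #B ≤ (x - (l + 1)) * #A := by
  have hl : (0 : ℝ) < l + 1 := by positivity
  have key : ∀ v : α, ((l : ℝ) + 1) * #(B.memberSubfamily v) ≤
      (x - (l + 1)) * #(A.memberSubfamily v) := by
    intro v
    have hsub := memberSubfamily_shadow_subset hBA v
    -- Deleting `v` from a member of `B` leaves a member of `A` that avoids `v`, so the link of `B`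
    -- at `v` injects into the part of `A` outside the star of `v`.
    have hle : #(B.memberSubfamily v) + #(A.memberSubfamily v) ≤ #A := by
      rw [← card_memberSubfamily_add_card_nonMemberSubfamily v A, add_comm]
      gcongr
      intro b hb
      rw [mem_memberSubfamily] at hb
      rw [mem_nonMemberSubfamily]
      refine ⟨?_, hb.2⟩
      have := hBA _ hb.1 v (mem_insert_self _ _)
      rwa [erase_insert hb.2] at this
    have hleR : (#(B.memberSubfamily v) : ℝ) + #(A.memberSubfamily v) ≤ #A := by
      exact_mod_cast hle
    rcases Nat.eq_zero_or_pos #(A.memberSubfamily v) with h0 | hpos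
    · have hB0 : B.memberSubfamily v = ∅ := by
        rw [eq_empty_iff_forall_notMem]
        intro b hb
        have hcard : #b = l + 1 := sized_memberSubfamily hB v hb
        have : 0 < #b := by omega
        obtain ⟨w, hw⟩ := card_pos.1 this
        have := hsub b hb w hw
        rw [card_eq_zero.1 h0] at this
        simp at this
      simp [hB0, h0]
    -- At a vertex of large degree the trivial bound `hle` is already enough; only small links need
    -- the hypothesis `hlink`.
    · rcases lt_or_ge ((#(A.memberSubfamily v) : ℝ) * x) ((l + 1) * #A) with h | h
      · exact hlink v hpos h
      · have := mul_le_mul_of_nonneg_left hleR hl.le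
        linarith
  have hsA := sum_card_memberSubfamily hA
  have hsB := sum_card_memberSubfamily hB
  have := sum_le_sum fun v (_ : v ∈ (univ : Finset α)) => key v
  rw [← mul_sum, ← mul_sum, ← Nat.cast_sum, ← Nat.cast_sum, hsA, hsB] at this
  push_cast at this
  refine le_of_mul_le_mul_left ?_ hl
  linarith

/-- Keevash's form of the Kruskal–Katona theorem: a family `A` of `l + 1`-sets with at most
`realChoose (l + 1) x` members contains the shadow of few `l + 2`-sets. -/
theorem card_le_of_shadow_subset {α : Type*} [Fintype α] [DecidableEq α] (l : ℕ) :
    ∀ (x : ℝ), (l : ℝ) < x → ∀ A B : Finset (Finset α),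
      (A : Set (Finset α)).Sized (l + 1) → (B : Set (Finset α)).Sized (l + 2) →
      (∀ b ∈ B, ∀ v ∈ b, b.erase v ∈ A) → (#A : ℝ) ≤ realChoose (l + 1) x →
      ((l : ℝ) + 2) * #B ≤ (x - (l + 1)) * #A := by
  induction l with
  | zero =>
    intro x hx A B hA hB hBA hc
    have hxpos : 0 < x := by simpa using hx
    refine card_le_of_link_bound hA hB hBA fun v hpos hlt => ?_
    -- A nonempty link makes the left side of `hlt` at least `x`, while `A` has at most `x`
    -- singletons: there are no small links.
    exfalso
    have h1 : (1 : ℝ) ≤ #(A.memberSubfamily v) := by exact_mod_cast hpos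
    have hc' : (#A : ℝ) ≤ x := by simpa [realChoose] using hc
    have := mul_le_mul_of_nonneg_right h1 hxpos.le
    push_cast at hlt
    linarith
  | succ l ih =>
    intro x hx A B hA hB hBA hc
    push_cast at hx
    have hxpos : 0 < x := lt_of_le_of_lt (by positivity) hx
    refine card_le_of_link_bound hA hB hBA fun v hpos hlt => ?_
    -- The recursion for `realChoose` turns smallness of the link into the size hypothesis at `x -
    -- 1`, and `x - 1 - (l + 1)` is exactly the coefficient wanted.
    have := ih (x - 1) (by linarith) _ _ (sized_memberSubfamily hA v)
      (sized_memberSubfamily hB v) (memberSubfamily_shadow_subset hBA v) ?_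
    · push_cast
      linarith
    · rw [realChoose] at hc
      push_cast at hc hlt
      have hl : (0 : ℝ) < l + 1 + 1 := by positivity
      rw [div_mul_eq_mul_div, le_div_iff₀ hl] at hc
      refine le_of_mul_le_mul_right ?_ hxpos
      linarith

/-- The quotient is a product of `l` factors `(n - i - j) / (n - i)`. Each is at least `exp(-j / (n
- i - j)) ≥ exp(-j / M)`, since `M` bounds every denominator from below. -/
theorem exp_mul_choose_le_realChoose (M j : ℝ) (hM : 0 < M) (hj : 0 ≤ j) (l : ℕ) :
    ∀ n : ℕ, M ≤ (n : ℝ) - l - j →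
      Real.exp (-(j * l / M)) * n.choose l ≤ realChoose l (n - j) := by
  induction l with
  | zero => intro n _; simp [realChoose]
  | succ l ih =>
    intro n hn
    push_cast at hn
    have hl : (0 : ℝ) ≤ l := Nat.cast_nonneg _
    cases n with
    | zero => push_cast at hn; linarith
    | succ n =>
      push_cast at hn ⊢
      have h := ih n (by linarith)
      have hch : ((n + 1).choose (l + 1) : ℝ) = (n + 1) / (l + 1) * n.choose l := by
        have := Nat.add_one_mul_choose_eq n l
        have h2 : ((n : ℝ) + 1) * n.choose l = (n + 1).choose (l + 1) * (l + 1) := by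
          exact_mod_cast this
        field_simp
        linarith
      rw [hch, realChoose]
      have e1 : (n : ℝ) + 1 - j - 1 = n - j := by ring
      rw [e1]
      have hpos : (0 : ℝ) < n + 1 - j := by linarith
      have hexp : Real.exp (-(j / M)) * (n + 1) ≤ n + 1 - j := by
        have h1 : ((n : ℝ) + 1) / (n + 1 - j) ≤ Real.exp (j / M) := by
          have h2 : ((n : ℝ) + 1) / (n + 1 - j) = j / (n + 1 - j) + 1 := by
            field_simp; ring
          rw [h2]
          refine le_trans (Real.add_one_le_exp _) (Real.exp_le_exp.2 ?_)
          exact div_le_div_of_nonneg_left hj hM (by linarith)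
        rw [div_le_iff₀ hpos] at h1
        rw [Real.exp_neg, inv_mul_le_iff₀ (Real.exp_pos _)]
        exact h1
      have e2 : -(j * ((l : ℝ) + 1) / M) = -(j / M) + -(j * l / M) := by ring
      rw [e2, Real.exp_add]
      have := mul_le_mul hexp h (by positivity) hpos.le
      have hl1 : (0 : ℝ) < l + 1 := by positivity
      calc _ = (Real.exp (-(j / M)) * (n + 1) * (Real.exp (-(j * l / M)) * n.choose l)) / (l + 1) := by
            ring
        _ ≤ ((n + 1 - j) * realChoose l (n - j)) / (l + 1) := by gcongr
        _ = _ := by ring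

/-! ### Expansion between consecutive slices -/

/-- The density of a family of `l`-sets in the slice of weight `l` of the cube. -/
noncomputable def sliceDensity (n l : ℕ) (F : Finset (Cube n)) : ℝ := #F / n.choose l

/-- Expansion of the shadow between two consecutive middle slices. -/
theorem sliceDensity_le_of_shadow_subset {n l : ℕ} {j : ℝ} (hj : 0 ≤ j)
    (hj2 : j ≤ 0.15 * n) (hl : 0 < l) (hln : (l : ℝ) ≤ 0.55 * n) {A B : Finset (Cube n)}
    (hA : (A : Set (Cube n)).Sized l) (hB : (B : Set (Cube n)).Sized (l + 1))
    (hBA : ∀ b ∈ B, ∀ v ∈ b, b.erase v ∈ A)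
    (ha : sliceDensity n l A ≤ Real.exp (-(2 * j))) :
    sliceDensity n (l + 1) B ≤ (1 - j / n) * sliceDensity n l A := by
  obtain ⟨l, rfl⟩ : ∃ l', l = l' + 1 := ⟨l - 1, by omega⟩
  push_cast at hln
  have hl0 : (0 : ℝ) ≤ l := Nat.cast_nonneg _
  have hn : (0 : ℝ) < n := by linarith
  have hlt : l + 1 < n := by
    have : ((l : ℝ) + 1) < n := by linarith
    exact_mod_cast this
  have hC : (0 : ℝ) < n.choose (l + 1) := by exact_mod_cast Nat.choose_pos hlt.le
  have hC2 : (0 : ℝ) < n.choose (l + 2) := by exact_mod_cast Nat.choose_pos hlt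
  rw [sliceDensity, div_le_iff₀ hC] at ha
  -- Here `0.3 = 1 - 0.55 - 0.15` bounds the remaining factors, and `0.55 / 0.3 < 2` explains the
  -- threshold `exp(-2j)`. Keevash's bound is then applied with `x = n - j`.
  have hM := exp_mul_choose_le_realChoose (0.3 * n) j (by linarith) hj (l + 1) n
    (by push_cast; linarith)
  have hle : Real.exp (-(2 * j)) ≤ Real.exp (-(j * (l + 1 : ℕ) / (0.3 * n))) := by
    apply Real.exp_le_exp.2
    rw [neg_le_neg_iff, div_le_iff₀ (by linarith)]
    push_cast
    nlinarith
  have hc := card_le_of_shadow_subset l (n - j) (by linarith) A B hA hB hBA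
    (ha.trans ((mul_le_mul_of_nonneg_right hle hC.le).trans hM))
  have hch : (n.choose (l + 2) : ℝ) * (l + 2) = n.choose (l + 1) * (n - (l + 1)) := by
    have := Nat.choose_succ_right_eq n (l + 1)
    have h2 : ((n - (l + 1) : ℕ) : ℝ) = n - (l + 1) := by
      rw [Nat.cast_sub hlt.le]; push_cast; ring
    rw [← h2]
    exact_mod_cast this
  rw [sliceDensity, sliceDensity, div_le_iff₀ hC2]
  have hA0 : (0 : ℝ) ≤ #A := Nat.cast_nonneg _
  have hnl : (0 : ℝ) < n - (l + 1) := by linarith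
  have e : (1 - j / n) * ((#A : ℝ) / n.choose (l + 1)) * n.choose (l + 2) =
      (1 - j / n) * (n - (l + 1)) * #A / (l + 2) := by
    have : (n.choose (l + 2) : ℝ) = n.choose (l + 1) * (n - (l + 1)) / (l + 2) := by
      field_simp; linarith
    rw [this]; field_simp
  rw [show l + 1 + 1 = l + 2 from rfl, e, le_div_iff₀ (by positivity)]
  have hjn : (n - j - (l + 1)) ≤ (1 - j / n) * (n - (l + 1)) := by
    have : (1 - j / n) * (n - ((l : ℝ) + 1)) = n - j - (l + 1) + j * (l + 1) / n := by
      field_simp; ring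
    rw [this]
    have : 0 ≤ j * ((l : ℝ) + 1) / n := by positivity
    linarith
  calc _ = ((l : ℝ) + 2) * #B := by ring
    _ ≤ _ := hc
    _ ≤ _ := mul_le_mul_of_nonneg_right hjn hA0

/-! ### Hall's condition for fractional matchings -/

/-- Hall's theorem for integer weights: an integer transportation plan along `r` exists as soon as
no set of sources outweighs its neighbourhood. -/
theorem exists_nat_transport_of_hall {α β : Type*} [Fintype α] [Fintype β] [DecidableEq α]
    [DecidableEq β] (r : α → β → Prop) [DecidableRel r] (a : α → ℕ) (b : β → ℕ)
    (hsum : ∑ x, a x = ∑ y, b y)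
    (hall : ∀ X : Finset α, ∑ x ∈ X, a x ≤ ∑ y with ∃ x ∈ X, r x y, b y) :
    ∃ w : α → β → ℕ, (∀ x y, 0 < w x y → r x y) ∧ (∀ x, ∑ y, w x y = a x) ∧
      ∀ y, ∑ x, w x y = b y := by
  -- Each vertex is replaced by as many copies as its weight, and the marriage theorem is applied to
  -- the copies. Equality of the totals makes the injection bijective, which gives the column sums.
  obtain ⟨f, hf, hr⟩ := (Fintype.all_card_le_filter_rel_iff_exists_injective
    (fun (p : Σ x, Fin (a x)) (q : Σ y, Fin (b y)) => r p.1 q.1)).1 (by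
      intro Z
      have h1 : Z ⊆ (Z.image Sigma.fst).sigma fun x => (univ : Finset (Fin (a x))) := by
        intro z hz
        simp only [mem_sigma, mem_univ, and_true]
        exact mem_image_of_mem _ hz
      have h2 : ((univ.filter fun y => ∃ x ∈ Z.image Sigma.fst, r x y).sigma
          fun y => (univ : Finset (Fin (b y)))) ⊆
          univ.filter fun q : (Σ y, Fin (b y)) => ∃ p ∈ Z, r p.1 q.1 := by
        intro q hq
        simp only [mem_sigma, mem_filter, mem_univ, true_and, and_true, mem_image,
          exists_exists_and_eq_and] at hq ⊢
        exact hq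
      refine (card_le_card h1).trans (le_trans ?_ (card_le_card h2))
      simpa [card_sigma] using hall (Z.image Sigma.fst))
  have hcard : Fintype.card (Σ x, Fin (a x)) = Fintype.card (Σ y, Fin (b y)) := by
    simpa using hsum
  have hbij : Function.Bijective f := (Fintype.bijective_iff_injective_and_card f).2 ⟨hf, hcard⟩
  refine ⟨fun x y => #(univ.filter fun p : Fin (a x) => (f ⟨x, p⟩).1 = y), ?_, ?_, ?_⟩
  · intro x y h
    obtain ⟨p, hp⟩ := card_pos.1 h
    rw [← (mem_filter.1 hp).2]
    exact hr ⟨x, p⟩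
  · intro x
    rw [← card_eq_sum_card_fiberwise (fun _ _ => mem_coe.2 (mem_univ _))]
    simp
  · intro y
    have h1 : ∑ x, #(univ.filter fun p : Fin (a x) => (f ⟨x, p⟩).1 = y) =
        #(univ.filter fun z : (Σ x, Fin (a x)) => (f z).1 = y) := by
      rw [← card_sigma]
      congr 1
      ext ⟨x, p⟩
      simp
    have h2 : #(univ.filter fun z : (Σ x, Fin (a x)) => (f z).1 = y) =
        #(univ.filter fun q : (Σ y, Fin (b y)) => q.1 = y) := by
      refine card_bij (fun z _ => f z) (by simp) (fun _ _ _ _ h => hf h) ?_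
      intro q hq
      obtain ⟨z, rfl⟩ := hbij.2 q
      exact ⟨z, by simpa using hq, rfl⟩
    have h3 : #(univ.filter fun q : (Σ y, Fin (b y)) => q.1 = y) =
        #(({y} : Finset β).sigma fun y => (univ : Finset (Fin (b y)))) := by
      congr 1
      ext ⟨y', p⟩
      simp
    rw [h1, h2, h3, card_sigma]
    simp

/-- A monotone fractional matching between rational weights exists under Hall's condition. -/
theorem monotoneFractionalMatching_of_hall {n : ℕ} {wU wV : Cube n → ℝ≥0} (a b : Cube n → ℕ)
    (M : ℝ≥0) (hU : ∀ x, wU x = a x * M) (hV : ∀ x, wV x = b x * M)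
    (hsum : ∑ x, a x = ∑ x, b x)
    (hall : ∀ X : Finset (Cube n), ∑ x ∈ X, a x ≤ ∑ y with ∃ x ∈ X, x ≤ y, b y) :
    MonotoneFractionalMatching wU wV := by
  obtain ⟨w, hw, hrow, hcol⟩ :=
    exists_nat_transport_of_hall (fun x y : Cube n => x ≤ y) a b hsum hall
  refine ⟨?_, fun x y => w x y * M, ?_, ?_, ?_⟩
  · simp_rw [hU, hV]
    rw [← sum_mul, ← sum_mul, ← Nat.cast_sum, ← Nat.cast_sum, hsum]
  · intro u _ v _ h
    refine hw u v (Nat.pos_of_ne_zero fun h0 => ?_)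
    simp [h0] at h
  · intro x _
    rw [hU, ← hrow x, Nat.cast_sum, sum_mul]
    refine sum_subset (subset_univ _) fun z _ hz => ?_
    simp only [weightSupport, mem_filter, mem_univ, true_and, not_not, hV, mul_eq_zero] at hz
    rcases hz with hz | hz
    · have h0 : b z = 0 := by exact_mod_cast hz
      rw [← hcol z, sum_eq_zero_iff] at h0
      simp [h0 x (mem_univ _)]
    · simp [hz]
  · intro y _
    rw [hV, ← hcol y, Nat.cast_sum, sum_mul]
    refine sum_subset (subset_univ _) fun z _ hz => ?_
    simp only [weightSupport, mem_filter, mem_univ, true_and, not_not, hU, mul_eq_zero] at hz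
    rcases hz with hz | hz
    · have h0 : a z = 0 := by exact_mod_cast hz
      rw [← hrow z, sum_eq_zero_iff] at h0
      simp [h0 y (mem_univ _)]
    · simp [hz]

theorem mem_cubeSlice {n k : ℕ} {x : Cube n} : x ∈ cubeSlice n k ↔ #x = k := by
  simp [cubeSlice]

theorem card_cubeSlice (n k : ℕ) : #(cubeSlice n k) = n.choose k := by
  simp [cubeSlice]

/-- Hall's condition for the matching of the random perturbation with a lower slice, in terms of
iterated upper shadows. -/
theorem matching_of_upShadow_bound {n k s t : ℕ} (htk : t ≤ k) (hkn : k ≤ n)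
    {S : Finset (Cube n)} (hS : S ⊆ cubeSlice n k) (hs : #S = s)
    (h : ∀ E ⊆ cubeSlice n (k - t),
      ((t : ℝ) + s / n.choose k) * sliceDensity n (k - t) E ≤
        t * sliceDensity n k (upShadow^[t] E) + #(S ∩ upShadow^[t] E) / n.choose k) :
    MonotoneFractionalMatching
      (((t : ℝ≥0) + (s : ℝ≥0) / (n.choose k : ℝ≥0)) • sliceMeasure n (k - t))
      ((t : ℝ≥0) • sliceMeasure n k + subsetMeasure n k S) := by
  have hN : 0 < n.choose k := Nat.choose_pos hkn
  have hN' : 0 < n.choose (k - t) := Nat.choose_pos (by omega)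
  have hcU : ∀ x, sliceMeasure n (k - t) x = if x ∈ cubeSlice n (k - t) then
      (n.choose (k - t) : ℝ≥0)⁻¹ else 0 := by
    intro x; rw [sliceMeasure, card_cubeSlice]
  have hcV : ∀ x, sliceMeasure n k x = if x ∈ cubeSlice n k then
      (n.choose k : ℝ≥0)⁻¹ else 0 := by
    intro x; rw [sliceMeasure, card_cubeSlice]
  have hdU : ∀ E, sliceDensity n (k - t) E = #E / n.choose (k - t) := fun E => rfl
  have hdV : ∀ E, sliceDensity n k E = #E / n.choose k := fun E => rfl
  have hcardU := card_cubeSlice n (k - t)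
  have hcardV := card_cubeSlice n k
  generalize n.choose k = N at *
  generalize n.choose (k - t) = N' at *
  have hNR : (N : ℝ≥0) ≠ 0 := by exact_mod_cast hN.ne'
  have hNR' : (N' : ℝ≥0) ≠ 0 := by exact_mod_cast hN'.ne'
  -- Both measures are multiples of `1 / (N N')`; the integer weights are the numerators, of common
  -- total `N' (t N + s)`.
  refine monotoneFractionalMatching_of_hall
    (fun x => if x ∈ cubeSlice n (k - t) then t * N + s else 0)
    (fun x => if x ∈ cubeSlice n k then (t + if x ∈ S then 1 else 0) * N' else 0)
    ((N : ℝ≥0) * N')⁻¹ ?_ ?_ ?_ ?_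
  · intro x
    simp only [Pi.smul_apply, hcU, smul_eq_mul]
    split_ifs
    · push_cast
      field_simp
    · simp
  · intro x
    simp only [Pi.smul_apply, Pi.add_apply, subsetMeasure, hcV, smul_eq_mul]
    split_ifs
    · push_cast
      field_simp
    · push_cast
      field_simp
      simp
    · simp
    · simp
  · rw [sum_ite_mem, univ_inter, sum_ite_mem, univ_inter, ← sum_mul, sum_add_distrib, sum_add_distrib,
      sum_boole,
      filter_mem_eq_inter, inter_eq_right.2 hS]
    simp only [sum_const, smul_eq_mul, hcardU, hcardV, hs, Nat.cast_id]
    ring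
  · intro X
    set E := X ∩ cubeSlice n (k - t)
    have hE : E ⊆ cubeSlice n (k - t) := inter_subset_right
    have h1 := h E hE
    set D := upShadow^[t] E with hD
    have hDsub : D ⊆ cubeSlice n k := by
      intro x hx
      obtain ⟨u, hu, _, hc⟩ := mem_upShadow_iterate_iff_exists_mem_card_add.1 hx
      have := mem_cubeSlice.1 (hE hu)
      rw [mem_cubeSlice]
      omega
    have hDN : D ⊆ univ.filter fun y => ∃ x ∈ X, x ≤ y := by
      intro x hx
      obtain ⟨u, hu, hux, _⟩ := mem_upShadow_iterate_iff_exists_mem_card_add.1 hx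
      simp only [mem_filter, mem_univ, true_and]
      exact ⟨u, (mem_inter.1 hu).1, hux⟩
    refine le_trans ?_ (sum_le_sum_of_subset hDN)
    rw [sum_ite_mem, sum_ite_mem, inter_eq_left.2 hDsub, ← sum_mul, sum_add_distrib, sum_add_distrib,
      sum_boole,
      filter_mem_eq_inter]
    simp only [sum_const, smul_eq_mul, Nat.cast_id]
    have hNr : (0 : ℝ) < N := by exact_mod_cast hN
    have hNr' : (0 : ℝ) < N' := by exact_mod_cast hN'
    rw [hdU, hdV] at h1
    have h2 : ((t : ℝ) + s / N) * (#E / N') = (#E * (t * N + s)) / (N * N') := by field_simp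
    have h3 : (t : ℝ) * (#D / N) + #(S ∩ D) / N = ((#D * t + #(D ∩ S)) * N') / (N * N') := by
      rw [inter_comm]; field_simp
    rw [h2, h3] at h1
    have := (div_le_div_iff_of_pos_right (by positivity)).1 h1
    rw [← mul_add]
    exact_mod_cast this

/-! ### Tail bounds for the hypergeometric distribution -/

/-- Sampling without replacement contains a given `j`-set with probability `∏ (s - i) / (N - i) ≤ (s
/ N) ^ j`. The indicator is needed since truncated subtraction would give `choose _ 0 = 1` for `j >
s`. -/
theorem choose_sub_sub_mul_pow_le {N s : ℕ} (hs : s ≤ N) (j : ℕ) :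
    ((N - j).choose (s - j) : ℝ) * (if j ≤ s then 1 else 0) ≤
      N.choose s * ((s : ℝ) / N) ^ j := by
  induction j with
  | zero => simp
  | succ j ih =>
    split_ifs with h
    · have hjs : j < s := h
      rw [if_pos hjs.le] at ih
      have h1 : (N - j) * ((N - (j + 1)).choose (s - (j + 1))) =
          (N - j).choose (s - j) * (s - j) := by
        have := Nat.add_one_mul_choose_eq (N - (j + 1)) (s - (j + 1))
        rwa [show N - (j + 1) + 1 = N - j by omega, show s - (j + 1) + 1 = s - j by omega] at this
      have hNj : (0 : ℝ) < ((N - j : ℕ) : ℝ) := by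
        have : 0 < N - j := by omega
        exact_mod_cast this
      have hN : (0 : ℝ) < N := by
        have : 0 < N := by omega
        exact_mod_cast this
      have h2 : ((N - (j + 1)).choose (s - (j + 1)) : ℝ) =
          (N - j).choose (s - j) * (((s - j : ℕ) : ℝ) / ((N - j : ℕ) : ℝ)) := by
        field_simp
        have : ((N - j : ℕ) : ℝ) * ((N - (j + 1)).choose (s - (j + 1)) : ℝ) =
          (N - j).choose (s - j) * ((s - j : ℕ) : ℝ) := by exact_mod_cast h1
        linarith
      have h3 : ((s - j : ℕ) : ℝ) / ((N - j : ℕ) : ℝ) ≤ (s : ℝ) / N := by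
        rw [div_le_div_iff₀ hNj hN, Nat.cast_sub hjs.le, Nat.cast_sub (by omega)]
        have : (s : ℝ) ≤ N := by exact_mod_cast hs
        have hj : (0 : ℝ) ≤ j := Nat.cast_nonneg _
        nlinarith
      rw [mul_one, h2, pow_succ, ← mul_assoc]
      rw [mul_one] at ih
      exact mul_le_mul ih h3 (by positivity) (by positivity)
    · simp only [mul_zero]; positivity

theorem card_filter_superset_powersetCard {α : Type*} [DecidableEq α] {X J : Finset α}
    (hJ : J ⊆ X) (s : ℕ) :
    (#((powersetCard s X).filter (J ⊆ ·)) : ℝ) =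
      (#X - #J).choose (s - #J) * (if #J ≤ s then 1 else 0) := by
  split_ifs with h
  · rw [mul_one, ← card_sdiff_of_subset hJ, ← card_powersetCard]
    norm_cast
    refine card_bij (fun S _ => S \ J) ?_ ?_ ?_
    · intro S hS
      simp only [mem_filter, mem_powersetCard] at hS ⊢
      exact ⟨sdiff_subset_sdiff hS.1.1 le_rfl, by rw [card_sdiff_of_subset hS.2, hS.1.2]⟩
    · intro S hS T hT hST
      simp only [mem_filter] at hS hT
      rw [← sdiff_union_of_subset hS.2, ← sdiff_union_of_subset hT.2, hST]
    · intro R hR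
      simp only [mem_powersetCard] at hR
      have hd : Disjoint R J := disjoint_of_subset_left hR.1 sdiff_disjoint
      refine ⟨R ∪ J, ?_, union_sdiff_cancel_right hd⟩
      simp only [mem_filter, mem_powersetCard]
      refine ⟨⟨union_subset (hR.1.trans sdiff_subset) hJ, ?_⟩, subset_union_right⟩
      rw [card_union_of_disjoint hd, hR.2]
      omega
  · simp only [mul_zero, Nat.cast_eq_zero, card_eq_zero, filter_eq_empty_iff, mem_powersetCard]
    intro S hS hJS
    exact h (hS.2 ▸ card_le_card hJS)

/-- Moment generating function bound for the hypergeometric distribution. -/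
theorem sum_pow_card_inter_le {α : Type*} [DecidableEq α] {X F : Finset α} (hF : F ⊆ X) {s : ℕ}
    (hs : s ≤ #X) {y : ℝ} (hy : 0 ≤ y) :
    ∑ S ∈ powersetCard s X, (1 + y) ^ #(S ∩ F) ≤
      (#X).choose s * (1 + (s : ℝ) / #X * y) ^ #F := by
  -- Expanding over the subsets `J` of `S ∩ F` reduces the moment generating function to the
  -- probabilities of `J ⊆ S`, each at most `ρ ^ #J`.
  have h1 : ∀ S ∈ powersetCard s X, (1 + y) ^ #(S ∩ F) =
      ∑ J ∈ F.powerset, if J ⊆ S then y ^ #J else 0 := by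
    intro S _
    rw [← sum_filter]
    have : F.powerset.filter (· ⊆ S) = (S ∩ F).powerset := by
      ext J; simp only [mem_filter, mem_powerset, subset_inter_iff]; tauto
    rw [this, add_comm, ← sum_pow_mul_eq_add_pow y 1 (S ∩ F)]
    simp
  rw [sum_congr rfl h1, sum_comm]
  have h2 : ∀ J ∈ F.powerset, (∑ S ∈ powersetCard s X, if J ⊆ S then y ^ #J else 0) ≤
      (#X).choose s * (((s : ℝ) / #X) * y) ^ #J := by
    intro J hJ
    have hJX : J ⊆ X := (mem_powerset.1 hJ).trans hF
    rw [← sum_filter, sum_const, nsmul_eq_mul, card_filter_superset_powersetCard hJX, mul_pow,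
      ← mul_assoc]
    exact mul_le_mul_of_nonneg_right (choose_sub_sub_mul_pow_le hs _) (by positivity)
  refine (sum_le_sum h2).trans (le_of_eq ?_)
  rw [← mul_sum, add_comm, ← sum_pow_mul_eq_add_pow _ 1 F]
  simp

/-- Chernoff's upper tail bound for the hypergeometric distribution. -/
theorem card_upper_tail_le {α : Type*} [DecidableEq α] {X F : Finset α} (hF : F ⊆ X) {s : ℕ}
    (hs : s ≤ #X) {θ r : ℝ} (hθ : 0 ≤ θ) (hθ1 : θ ≤ 1) :
    (#((powersetCard s X).filter
      fun S => (s : ℝ) / #X * #F + r ≤ #(S ∩ F)) : ℝ) ≤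
      (#X).choose s * Real.exp (θ ^ 2 * #F - θ * r) := by
  set ρ : ℝ := (s : ℝ) / #X
  have hρ0 : 0 ≤ ρ := by positivity
  have hρ1 : ρ ≤ 1 := div_le_one_of_le₀ (by exact_mod_cast hs) (by positivity)
  have hy : 0 ≤ Real.exp θ - 1 := by linarith [Real.one_le_exp hθ]
  have hq : Real.exp θ - 1 ≤ θ + θ ^ 2 := by
    have := Real.abs_exp_sub_one_sub_id_le (x := θ) (by rwa [abs_of_nonneg hθ])
    linarith [le_abs_self (Real.exp θ - 1 - θ)]
  have hmgf := sum_pow_card_inter_le hF hs hy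
  rw [add_sub_cancel] at hmgf
  have hbase : (1 + ρ * (Real.exp θ - 1)) ^ #F ≤ Real.exp ((ρ * θ + θ ^ 2) * #F) := by
    have h1 : 1 + ρ * (Real.exp θ - 1) ≤ Real.exp (ρ * θ + θ ^ 2) := by
      have := Real.add_one_le_exp (ρ * θ + θ ^ 2)
      nlinarith [mul_le_mul_of_nonneg_left hq hρ0, sq_nonneg θ]
    calc _ ≤ Real.exp (ρ * θ + θ ^ 2) ^ #F := pow_le_pow_left₀ (by positivity) h1 _
      _ = _ := by rw [← Real.exp_nat_mul, mul_comm]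
  have hlow : (#((powersetCard s X).filter fun S => ρ * #F + r ≤ #(S ∩ F)) : ℝ) *
      Real.exp (θ * (ρ * #F + r)) ≤ ∑ S ∈ powersetCard s X, Real.exp θ ^ #(S ∩ F) := by
    rw [← nsmul_eq_mul]
    refine (card_nsmul_le_sum _ _ _ ?_).trans
      (sum_le_sum_of_subset_of_nonneg (filter_subset _ _) fun _ _ _ => by positivity)
    intro S hS
    rw [← Real.exp_nat_mul]
    apply Real.exp_le_exp.2
    have := (mem_filter.1 hS).2
    nlinarith
  have hfin := hlow.trans (hmgf.trans (mul_le_mul_of_nonneg_left hbase (Nat.cast_nonneg _)))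
  rw [← le_div_iff₀ (Real.exp_pos _), mul_div_assoc, ← Real.exp_sub] at hfin
  refine hfin.trans (le_of_eq ?_)
  congr 2
  ring

/-- Chernoff's lower tail bound for the hypergeometric distribution. -/
theorem card_lower_tail_le {α : Type*} [DecidableEq α] {X F : Finset α} (hF : F ⊆ X) {s : ℕ}
    (hs : s ≤ #X) {θ r : ℝ} (hθ : 0 ≤ θ) (hθ1 : θ ≤ 1) :
    (#((powersetCard s X).filter
      fun S => (#(S ∩ F) : ℝ) + r ≤ (s : ℝ) / #X * #F) : ℝ) ≤
      (#X).choose s * Real.exp (θ ^ 2 * #F - θ * r) := by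
  rcases X.eq_empty_or_nonempty with rfl | hX
  · have hF0 : F = ∅ := subset_empty.1 hF
    subst hF0
    have hs0 : s = 0 := by simpa using hs
    subst hs0
    by_cases hr : r ≤ 0
    · simp only [card_empty]
      have : 0 ≤ θ ^ 2 * (0 : ℕ) - θ * r := by nlinarith
      simpa [hr] using mul_nonneg hθ (by linarith : 0 ≤ -r)
    · simp [hr, Real.exp_nonneg]
  have hXpos : (0 : ℝ) < #X := by exact_mod_cast hX.card_pos
  -- The complement of a uniform `s`-set is a uniform set of size `#X - s`, and a deficit of `S` on
  -- `F` is an excess of `X \ S`.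
  have h := card_upper_tail_le hF (Nat.sub_le (#X) s) (r := r) hθ hθ1
  rw [Nat.choose_symm hs] at h
  refine le_trans ?_ h
  norm_cast
  refine card_le_card_of_injOn (fun S => X \ S) ?_ ?_
  · intro S hS
    simp only [coe_filter, mem_powersetCard, Set.mem_ofPred_eq] at hS ⊢
    obtain ⟨⟨hSX, hSs⟩, hS2⟩ := hS
    refine ⟨⟨sdiff_subset, by rw [card_sdiff_of_subset hSX, hSs]⟩, ?_⟩
    have h1 : #((X \ S) ∩ F) + #(S ∩ F) = #F := by
      rw [← card_union_of_disjoint]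
      · congr 1
        ext x
        have := @hF x
        simp only [mem_union, mem_inter, mem_sdiff]
        tauto
      · rw [disjoint_left]
        intro x; simp only [mem_inter, mem_sdiff]; tauto
    have h2 : (#((X \ S) ∩ F) : ℝ) + #(S ∩ F) = #F := by exact_mod_cast h1
    rw [Nat.cast_sub hs, sub_div, div_self hXpos.ne', sub_mul]
    linarith
  · intro S hS T hT hST
    simp only [coe_filter, mem_powersetCard, Set.mem_ofPred_eq] at hS hT
    simp only at hST
    rw [← Finset.sdiff_sdiff_eq_self hS.1.1, ← Finset.sdiff_sdiff_eq_self hT.1.1, hST]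

/-! ### Greedy covers and containers in bipartite graphs -/

/-- The number of subsets of size at most `h` of a set of size `M`. -/
theorem card_filter_card_le_le {α : Type*} [DecidableEq α] (X : Finset α) (h : ℕ) {x : ℝ}
    (hx : 0 < x) (hx1 : x ≤ 1) :
    (#(X.powerset.filter fun T => #T ≤ h) : ℝ) ≤ (x⁻¹) ^ h * Real.exp (x * #X) := by
  have h1 : (#(X.powerset.filter fun T => #T ≤ h) : ℝ) * x ^ h ≤ ∑ T ∈ X.powerset, x ^ #T := by
    rw [← nsmul_eq_mul]
    refine (card_nsmul_le_sum _ _ _ ?_).trans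
      (sum_le_sum_of_subset_of_nonneg (filter_subset _ _) fun _ _ _ => by positivity)
    intro T hT
    exact pow_le_pow_of_le_one hx.le hx1 (mem_filter.1 hT).2
  have h2 : ∑ T ∈ X.powerset, x ^ #T = (x + 1) ^ #X := by
    rw [← sum_pow_mul_eq_add_pow x 1 X]; simp
  have h3 : (x + 1) ^ #X ≤ Real.exp (x * #X) := by
    rw [mul_comm, Real.exp_nat_mul]
    exact pow_le_pow_left₀ (by positivity) (Real.add_one_le_exp x) _
  rw [h2] at h1
  rw [inv_pow, inv_mul_eq_div, le_div_iff₀ (by positivity)]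
  exact h1.trans h3

theorem sum_card_filter_comm {α β : Type*} (B : Finset α) (A : Finset β) (R : α → β → Prop)
    [∀ x y, Decidable (R x y)] :
    ∑ x ∈ B, #(A.filter fun y => R x y) = ∑ y ∈ A, #(B.filter fun x => R x y) := by
  simp_rw [card_filter]
  exact sum_comm

/-- Greedy covering: `h` vertices of `B` dominate all but an exponentially small fraction of the
vertices having at least `g` neighbours in `B`. -/
theorem exists_greedy_cover {α β : Type*} [DecidableEq α] {B : Finset α} {H : Finset β}
    (R : α → β → Prop) [∀ x y, Decidable (R x y)] {g : ℝ} (hB : B.Nonempty)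
    (hg : ∀ y ∈ H, g ≤ #(B.filter fun x => R x y)) (h : ℕ) :
    ∃ T ⊆ B, #T ≤ h ∧ (#(H.filter fun y => ∀ x ∈ T, ¬ R x y) : ℝ) ≤
      Real.exp (-(h * (g / #B))) * #H := by
  have hBpos : (0 : ℝ) < #B := by exact_mod_cast hB.card_pos
  induction h with
  | zero => exact ⟨∅, empty_subset _, by simp, by simp⟩
  | succ h ih =>
    obtain ⟨T, hTB, hTh, hT⟩ := ih
    set U := H.filter fun y => ∀ x ∈ T, ¬ R x y with hU
    -- Averaging over `B`: some vertex dominates at least the fraction `g / #B` of what is still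
    -- uncovered.
    have hsum : ∑ x ∈ B, g * #U / #B ≤ ∑ x ∈ B, (#(U.filter fun y => R x y) : ℝ) := by
      rw [← Nat.cast_sum, sum_card_filter_comm, sum_const, nsmul_eq_mul, mul_div_cancel₀ _ hBpos.ne',
        Nat.cast_sum, mul_comm, ← nsmul_eq_mul]
      exact card_nsmul_le_sum _ _ _ fun y hy => hg y (mem_filter.1 hy).1
    obtain ⟨x, hx, hxU⟩ := exists_le_of_sum_le hB hsum
    refine ⟨insert x T, insert_subset hx hTB, (card_insert_le _ _).trans (by omega), ?_⟩
    have hU' : H.filter (fun y => ∀ z ∈ insert x T, ¬ R z y) = U.filter fun y => ¬ R x y := by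
      ext y; simp only [hU, mem_filter, forall_mem_insert]; tauto
    rw [hU']
    have hsplit : (#(U.filter fun y => R x y) : ℝ) + #(U.filter fun y => ¬ R x y) = #U := by
      exact_mod_cast card_filter_add_card_filter_not (s := U) fun y => R x y
    have h1 : (#(U.filter fun y => ¬ R x y) : ℝ) ≤ Real.exp (-(g / #B)) * #U := by
      have h2 := mul_le_mul_of_nonneg_right (Real.one_sub_le_exp_neg (g / #B))
        (Nat.cast_nonneg (α := ℝ) #U)
      have h3 : (1 - g / #B) * #U = #U - g * #U / #B := by ring
      linarith
    refine h1.trans ((mul_le_mul_of_nonneg_left hT (Real.exp_nonneg _)).trans (le_of_eq ?_))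
    rw [← mul_assoc, ← Real.exp_add]
    push_cast
    congr 2
    ring

/-- In a nearly biregular bipartite graph a poorly expanding set `B` contains few vertices that
dominate most of its neighbourhood `A`. -/
theorem exists_sparse_cover {α β : Type*} [DecidableEq α] {B : Finset α} {A : Finset β}
    (R : α → β → Prop) [∀ x y, Decidable (R x y)] {r r' : ℕ} (hB : B.Nonempty)
    (hr : ∀ x ∈ B, #(A.filter fun y => R x y) = r)
    (hr' : ∀ y ∈ A, #(B.filter fun x => R x y) ≤ r') (h : ℕ) :
    ∃ T ⊆ B, #T ≤ h ∧ (r' : ℝ) * #(A.filter fun y => ∀ x ∈ T, ¬ R x y) ≤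
      2 * (r' * #A - r * #B) + r' * #A * Real.exp (-(h * (r' / (2 * #B)))) := by
  set H := A.filter fun y => (r' : ℝ) / 2 ≤ #(B.filter fun x => R x y) with hH
  set L := A.filter fun y => ¬ (r' : ℝ) / 2 ≤ #(B.filter fun x => R x y) with hL
  obtain ⟨T, hTB, hTh, hT⟩ := exists_greedy_cover (H := H) R hB
    (fun y hy => (mem_filter.1 hy).2) h
  refine ⟨T, hTB, hTh, ?_⟩
  -- The quantity `r' #A - r #B` is the total degree deficit on the side `A`, and every vertex of
  -- `L` contributes more than `r' / 2` to it. The greedy cover handles `H`.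
  have hlow : (r' : ℝ) * #L ≤ 2 * (r' * #A - r * #B) := by
    have h1 : (r' : ℝ) * #A - r * #B = ∑ y ∈ A, ((r' : ℝ) - #(B.filter fun x => R x y)) := by
      have hcomm := sum_card_filter_comm B A R
      rw [sum_congr rfl hr, sum_const, smul_eq_mul] at hcomm
      have hcommR : (#B : ℝ) * r = ∑ y ∈ A, (#(B.filter fun x => R x y) : ℝ) := by
        exact_mod_cast hcomm
      rw [sum_sub_distrib, ← hcommR, sum_const, nsmul_eq_mul]
      ring
    have h2 : (#L : ℝ) * (r' / 2) ≤ ∑ y ∈ A, ((r' : ℝ) - #(B.filter fun x => R x y)) := by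
      rw [← nsmul_eq_mul]
      refine (card_nsmul_le_sum _ _ _ ?_).trans
        (sum_le_sum_of_subset_of_nonneg (filter_subset _ A) fun y hy _ => ?_)
      · intro y hy
        have := (mem_filter.1 hy).2
        linarith
      · have : (#(B.filter fun x => R x y) : ℝ) ≤ r' := by exact_mod_cast hr' y hy
        linarith
    linarith
  have hsub : A.filter (fun y => ∀ x ∈ T, ¬ R x y) ⊆
      (H.filter fun y => ∀ x ∈ T, ¬ R x y).disjUnion L (by
        rw [disjoint_left]; intro y; simp only [hH, hL, mem_filter]; tauto) := by
    intro y
    simp only [hH, hL, mem_filter, mem_disjUnion]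
    tauto
  have hcard := card_le_card hsub
  rw [card_disjUnion] at hcard
  have hcardR : (#(A.filter fun y => ∀ x ∈ T, ¬ R x y) : ℝ) ≤
      #(H.filter fun y => ∀ x ∈ T, ¬ R x y) + #L := by exact_mod_cast hcard
  have hHA : (#H : ℝ) ≤ #A := by exact_mod_cast card_filter_le _ _
  have hexp : Real.exp (-(h * ((r' : ℝ) / 2 / #B))) = Real.exp (-(h * (r' / (2 * #B)))) := by
    rw [div_div]
  rw [hexp] at hT
  have h3 := hT.trans (mul_le_mul_of_nonneg_left hHA (Real.exp_nonneg _))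
  have h4 := mul_le_mul_of_nonneg_left (hcardR.trans (add_le_add_left h3 _))
    (Nat.cast_nonneg (α := ℝ) r')
  linarith

/-- The vertices of `X` with at least half of their `r` neighbours in `A'`. -/
def halfNeighbours {α β : Type*} (X : Finset α) (A' : Finset β) (R : α → β → Prop)
    [∀ x y, Decidable (R x y)] (r : ℕ) : Finset α :=
  X.filter fun x => r ≤ 2 * #(A'.filter fun y => R x y)

/-- A vertex of `B` missed by the container sends at least half of its `r` edges to `A \ A'`, which
receives at most `r' #(A \ A')` edges. -/
theorem card_sdiff_halfNeighbours_le {α β : Type*} [DecidableEq α] [DecidableEq β]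
    {X B : Finset α} {A A' : Finset β} (R : α → β → Prop) [∀ x y, Decidable (R x y)] {r r' : ℕ}
    (hBX : B ⊆ X) (hr : ∀ x ∈ B, #(A.filter fun y => R x y) = r)
    (hr' : ∀ y ∈ A, #(X.filter fun x => R x y) ≤ r') :
    r * #(B \ halfNeighbours X A' R r) ≤ 2 * (r' * #(A \ A')) := by
  have h1 : ∀ x ∈ B \ halfNeighbours X A' R r, r ≤ 2 * #((A \ A').filter fun y => R x y) := by
    intro x hx
    simp only [halfNeighbours, mem_sdiff, mem_filter, not_and, not_le] at hx
    have h2 := hx.2 (hBX hx.1)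
    have h3 : #(A.filter fun y => R x y) ≤
        #(A'.filter fun y => R x y) + #((A \ A').filter fun y => R x y) := by
      refine (card_le_card fun y hy => ?_).trans (card_union_le _ _)
      simp only [mem_filter, mem_union, mem_sdiff] at hy ⊢
      tauto
    rw [hr x hx.1] at h3
    omega
  have h2 : #(B \ halfNeighbours X A' R r) * r ≤
      ∑ x ∈ B \ halfNeighbours X A' R r, 2 * #((A \ A').filter fun y => R x y) := by
    simpa using card_nsmul_le_sum _ _ _ h1
  rw [← mul_sum, sum_card_filter_comm] at h2
  have h3 : ∑ y ∈ A \ A', #((B \ halfNeighbours X A' R r).filter fun x => R x y) ≤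
      #(A \ A') * r' := by
    simpa using sum_le_card_nsmul (A \ A') _ r' fun y hy =>
      (card_le_card (filter_subset_filter _ (sdiff_subset.trans hBX))).trans
        (hr' y (mem_sdiff.1 hy).1)
  rw [mul_comm]
  refine h2.trans ?_
  rw [mul_comm r']
  omega

/-- A superfluous vertex of the container sends at least `r / 2` edges to `A`. Since `B` already
uses `r #B` of the at most `r' #A` edges at `A`, few such vertices exist. -/
theorem card_halfNeighbours_sdiff_le {α β : Type*} [DecidableEq α]
    {X B : Finset α} {A A' : Finset β} (R : α → β → Prop) [∀ x y, Decidable (R x y)] {r r' : ℕ}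
    (hBX : B ⊆ X) (hA : A' ⊆ A) (hr : ∀ x ∈ B, #(A.filter fun y => R x y) = r)
    (hr' : ∀ y ∈ A, #(X.filter fun x => R x y) ≤ r') :
    (r : ℝ) * #(halfNeighbours X A' R r \ B) ≤ 2 * (r' * #A - r * #B) := by
  have h1 : #(halfNeighbours X A' R r \ B) * r ≤
      ∑ x ∈ halfNeighbours X A' R r \ B, 2 * #(A.filter fun y => R x y) := by
    rw [← smul_eq_mul]
    refine card_nsmul_le_sum _ _ _ fun x hx => ?_
    have := (mem_filter.1 (mem_sdiff.1 hx).1).2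
    exact this.trans (Nat.mul_le_mul_left _ (card_le_card (filter_subset_filter _ hA)))
  have h2 : ∑ x ∈ halfNeighbours X A' R r \ B, #(A.filter fun y => R x y) ≤
      ∑ x ∈ X \ B, #(A.filter fun y => R x y) :=
    sum_le_sum_of_subset (sdiff_subset_sdiff (filter_subset _ _) le_rfl)
  have h3 : ∑ x ∈ X \ B, #(A.filter fun y => R x y) + #B * r ≤ #A * r' := by
    have h4 : #B * r = ∑ x ∈ B, #(A.filter fun y => R x y) := by
      rw [sum_congr rfl hr]; simp
    rw [h4, sum_sdiff hBX, sum_card_filter_comm]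
    simpa using sum_le_card_nsmul A _ r' hr'
  rw [← mul_sum] at h1
  have h5 : #(halfNeighbours X A' R r \ B) * r + 2 * (#B * r) ≤ 2 * (#A * r') := by omega
  have h6 : (#(halfNeighbours X A' R r \ B) : ℝ) * r + 2 * (#B * r) ≤ 2 * (#A * r') := by
    exact_mod_cast h5
  linarith

/-! ### Expansion along iterated shadows -/

theorem sized_of_subset_cubeSlice {n k : ℕ} {B : Finset (Cube n)} (hB : B ⊆ cubeSlice n k) :
    (B : Set (Cube n)).Sized k := fun _ hx => mem_cubeSlice.1 (hB hx)

theorem subset_cubeSlice_of_sized {n k : ℕ} {B : Finset (Cube n)}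
    (hB : (B : Set (Cube n)).Sized k) : B ⊆ cubeSlice n k := fun _ hx => mem_cubeSlice.2 (hB hx)

theorem sliceDensity_nonneg (n k : ℕ) (B : Finset (Cube n)) : 0 ≤ sliceDensity n k B := by
  unfold sliceDensity; positivity

theorem sliceDensity_le_one {n k : ℕ} {B : Finset (Cube n)} (hB : B ⊆ cubeSlice n k) :
    sliceDensity n k B ≤ 1 := by
  refine div_le_one_of_le₀ ?_ (by positivity)
  rw [← card_cubeSlice]
  exact_mod_cast card_le_card hB

theorem erase_mem_shadow_of_mem {n : ℕ} (B : Finset (Cube n)) :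
    ∀ b ∈ B, ∀ v ∈ b, b.erase v ∈ B.shadow := fun _ hb _ hv => erase_mem_shadow hb hv

theorem shadow_iterate_step {n k i : ℕ} (hik : i + 1 < k) (hk : (k : ℝ) ≤ 0.55 * n)
    {B : Finset (Cube n)} (hB : (B : Set (Cube n)).Sized k) {j : ℝ} (hj : 0 ≤ j)
    (hj2 : j ≤ 0.15 * n)
    (h : sliceDensity n (k - (i + 1)) (shadow^[i + 1] B) ≤ Real.exp (-(2 * j))) :
    sliceDensity n (k - i) (shadow^[i] B) ≤
      (1 - j / n) * sliceDensity n (k - (i + 1)) (shadow^[i + 1] B) := by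
  have e : k - i = k - (i + 1) + 1 := by omega
  have hi := hB.shadow_iterate (k := i)
  have hi1 := hB.shadow_iterate (k := i + 1)
  rw [e] at hi ⊢
  refine sliceDensity_le_of_shadow_subset hj hj2 (by omega) ?_ hi1 hi ?_ h
  · have : ((k - (i + 1) : ℕ) : ℝ) ≤ k := by exact_mod_cast Nat.sub_le _ _
    linarith
  · rw [Function.iterate_succ_apply']
    exact erase_mem_shadow_of_mem _

/-- The case `j = 0` of the one-step expansion is the normalized matching property; its hypothesis
is just density at most `1`. -/
theorem chain_mono {f : ℕ → ℝ} {t n : ℕ} (hf1 : ∀ i ≤ t, f i ≤ 1)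
    (hstep : ∀ i < t, ∀ j : ℝ, 0 ≤ j → j ≤ 0.15 * n → f (i + 1) ≤ Real.exp (-(2 * j)) →
      f i ≤ (1 - j / n) * f (i + 1)) :
    ∀ i i', i ≤ i' → i' ≤ t → f i ≤ f i' := by
  intro i i' hii'
  induction i', hii' using Nat.le_induction with
  | base => intro _; exact le_rfl
  | succ i' _ ih =>
    intro h
    refine (ih (by omega)).trans ?_
    simpa using hstep i' h 0 le_rfl (by positivity) (by simpa using hf1 _ h)

/-- By monotonicity the smallness of the last density holds at all levels, and each step adds at
least `(j / n) f 0`. -/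
theorem chain_expansion {f : ℕ → ℝ} {t n : ℕ} (hf1 : ∀ i ≤ t, f i ≤ 1)
    (hstep : ∀ i < t, ∀ j : ℝ, 0 ≤ j → j ≤ 0.15 * n → f (i + 1) ≤ Real.exp (-(2 * j)) →
      f i ≤ (1 - j / n) * f (i + 1)) {j : ℝ} (hj : 0 ≤ j) (hj2 : j ≤ 0.15 * n)
    (ht : f t ≤ Real.exp (-(2 * j))) : f 0 * (1 + t * j / n) ≤ f t := by
  have hmono := chain_mono hf1 hstep
  have key : ∀ i ≤ t, f 0 * (1 + i * j / n) ≤ f i := by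
    intro i
    induction i with
    | zero => simp
    | succ i ih =>
      intro hi
      have h1 := ih (by omega)
      have h2 := hstep i hi j hj hj2 ((hmono _ _ hi le_rfl).trans ht)
      have h3 := mul_le_mul_of_nonneg_left (hmono 0 (i + 1) (by omega) hi)
        (by positivity : 0 ≤ j / n)
      push_cast
      have h4 : f 0 * (1 + (i + 1) * j / n) = f 0 * (1 + i * j / n) + j / n * f 0 := by ring
      linarith
  exact key t le_rfl

/-- If the total expansion along a chain is at most `1 + 1 / t`, then the density is not too small
and the expansion is still bounded below in terms of the logarithm of the density. -/
theorem gap_of_chain {f0 ft v t : ℝ} {n : ℕ} (hn : 0 < n) (ht : 10 ≤ t) (hv : 0 < v)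
    (hv2 : v ≤ 1 / 2) (h0v : f0 ≤ v) (hvt : v ≤ ft)
    (hchain : ∀ j : ℝ, 0 ≤ j → j ≤ 0.15 * n → ft ≤ Real.exp (-(2 * j)) →
      f0 * (1 + t * j / n) ≤ ft)
    (hsmall : ft < f0 * (1 + 1 / t)) :
    -Real.log v < 4 * n / t ^ 2 ∧ t * -Real.log v / (8 * n) * v ≤ ft - f0 := by
  have hn' : (0 : ℝ) < n := by exact_mod_cast hn
  have ht0 : 0 < t := by linarith
  have h1t : 1 / t ≤ 0.1 := by rw [div_le_iff₀ ht0]; linarith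
  have hf0 : 0 < f0 := by
    by_contra h
    have : f0 * (1 + 1 / t) ≤ 0 := mul_nonpos_of_nonpos_of_nonneg (by linarith) (by positivity)
    linarith
  have hft : ft ≤ 1.1 * v := by nlinarith
  set L := -Real.log v with hL
  have hvL : v = Real.exp (-L / 2) * Real.exp (-L / 2) := by
    rw [← Real.exp_add, hL]
    ring_nf
    exact (Real.exp_log hv).symm
  have hL0 : 0 ≤ L := by
    rw [hL]; have := Real.log_nonpos hv.le (by linarith); linarith
  -- As `ft ≤ 1.1 v` and `√v ≤ 0.8`, one gets `ft ≤ √v`. This makes every `j ≤ L / 4` admissible in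
  -- `hchain`.
  have hs : ft ≤ Real.exp (-L / 2) := by
    have hu := Real.exp_pos (-L / 2)
    have : Real.exp (-L / 2) ≤ 0.8 := by
      by_contra hc
      push Not at hc
      nlinarith
    nlinarith
  have hnt : (n : ℝ) / t ^ 2 ≤ 0.15 * n := by
    rw [div_le_iff₀ (by positivity)]
    have : (100 : ℝ) ≤ t ^ 2 := by nlinarith
    nlinarith
  have hlt : L < 4 * n / t ^ 2 := by
    by_contra hc
    push Not at hc
    have hj : 2 * ((n : ℝ) / t ^ 2) ≤ L / 2 := by
      have : 4 * (n : ℝ) / t ^ 2 = 4 * (n / t ^ 2) := by ring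
      linarith
    -- The choice `j = n / t²` makes the gain exactly `1 + 1/t`, contradicting `hsmall`.
    have := hchain (n / t ^ 2) (by positivity) hnt
      (hs.trans (Real.exp_le_exp.2 (by linarith)))
    have e : t * ((n : ℝ) / t ^ 2) / n = 1 / t := by field_simp
    rw [e] at this
    linarith
  refine ⟨hlt, ?_⟩
  have h4 : 4 * (n : ℝ) / t ^ 2 = 4 * (n / t ^ 2) := by ring
  have := hchain (L / 4) (by positivity) (by linarith)
    (hs.trans (Real.exp_le_exp.2 (by linarith)))
  have hf0v : v / 2 ≤ f0 := by nlinarith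
  have h5 : t * L / (8 * n) * v ≤ f0 * (t * (L / 4) / n) := by
    have e : f0 * (t * (L / 4) / n) = t * L / (8 * n) * (2 * f0) := by field_simp; ring
    rw [e]
    exact mul_le_mul_of_nonneg_left (by linarith) (by positivity)
  linarith

/-! ### Containers in the slices -/

theorem card_filter_superset_cubeSlice {n k : ℕ} (hk : 0 < k) {y : Cube n} (hy : #y = k - 1)
    (hkn : k ≤ n) :
    #((cubeSlice n k).filter fun x => y ⊆ x) = n - k + 1 := by
  have h := card_filter_superset_powersetCard (subset_univ y) k
  rw [if_pos (by omega), card_univ, Fintype.card_fin, hy, show n - (k - 1) = n - k + 1 by omega,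
    show k - (k - 1) = 1 by omega, Nat.choose_one_right, mul_one] at h
  exact_mod_cast h

theorem card_filter_subset_cubeSlice {n k : ℕ} (hk : 0 < k) {x : Cube n} (hx : #x = k) :
    #((cubeSlice n (k - 1)).filter fun y => y ⊆ x) = k := by
  have : (cubeSlice n (k - 1)).filter (fun y => y ⊆ x) = powersetCard (k - 1) x := by
    ext y; simp only [mem_filter, mem_cubeSlice, mem_powersetCard]; tauto
  rw [this, card_powersetCard, hx, Nat.choose_symm_of_eq_add (show k = (k - 1) + 1 by omega),
    Nat.choose_one_right]

theorem choose_pred_mul {n k : ℕ} (hk : 0 < k) (hkn : k ≤ n) :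
    (n.choose (k - 1) : ℝ) * (n - k + 1 : ℕ) = n.choose k * k := by
  have := Nat.choose_succ_right_eq n (k - 1)
  rw [show k - 1 + 1 = k by omega, show n - (k - 1) = n - k + 1 by omega] at this
  exact_mod_cast this.symm

theorem mem_shadow_iff_of_sized {n k : ℕ} (hk : 0 < k) {B : Finset (Cube n)}
    (hB : B ⊆ cubeSlice n k) {y : Cube n} :
    y ∈ B.shadow ↔ y ∈ cubeSlice n (k - 1) ∧ ∃ x ∈ B, y ⊆ x := by
  rw [mem_shadow_iff_exists_mem_card_add_one, mem_cubeSlice]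
  constructor
  · rintro ⟨x, hx, hyx, hc⟩
    have := mem_cubeSlice.1 (hB hx)
    exact ⟨by omega, x, hx, hyx⟩
  · rintro ⟨hy, x, hx, hyx⟩
    have := mem_cubeSlice.1 (hB hx)
    exact ⟨x, hx, hyx, by omega⟩

theorem mem_upShadow_iff_of_sized {n k : ℕ} (hk : 0 < k) {B : Finset (Cube n)}
    (hB : B ⊆ cubeSlice n (k - 1)) {y : Cube n} :
    y ∈ B.upShadow ↔ y ∈ cubeSlice n k ∧ ∃ x ∈ B, x ⊆ y := by
  rw [mem_upShadow_iff_exists_mem_card_add_one, mem_cubeSlice]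
  constructor
  · rintro ⟨x, hx, hyx, hc⟩
    have := mem_cubeSlice.1 (hB hx)
    exact ⟨by omega, x, hx, hyx⟩
  · rintro ⟨hy, x, hx, hyx⟩
    have := mem_cubeSlice.1 (hB hx)
    exact ⟨x, hx, hyx, by omega⟩

/-- Approximation of a set with small lower shadow, determined by few of its points. -/
theorem exists_shadow_approx {n k : ℕ} (hk : 0 < k) (hkn : k ≤ n) {B : Finset (Cube n)}
    (hB : B ⊆ cubeSlice n k) (hne : B.Nonempty) (h : ℕ) {κ : ℝ}
    (hκ : Real.exp (-(h * ((n - k + 1 : ℕ) / (2 * #B)))) ≤ κ) :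
    ∃ T ⊆ cubeSlice n k, #T ≤ h ∧
      sliceDensity n k (B \ halfNeighbours (cubeSlice n k) T.shadow (fun x y => y ⊆ x) k) ≤
        4 * (sliceDensity n (k - 1) B.shadow - sliceDensity n k B) +
          2 * κ * sliceDensity n (k - 1) B.shadow ∧
      sliceDensity n k (halfNeighbours (cubeSlice n k) T.shadow (fun x y => y ⊆ x) k \ B) ≤
        2 * (sliceDensity n (k - 1) B.shadow - sliceDensity n k B) := by
  set R : Cube n → Cube n → Prop := fun x y => y ⊆ x with hR
  have hr : ∀ x ∈ B, #(B.shadow.filter fun y => R x y) = k := by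
    intro x hx
    rw [← card_filter_subset_cubeSlice hk (mem_cubeSlice.1 (hB hx))]
    congr 1
    ext y
    simp only [mem_filter, mem_shadow_iff_of_sized hk hB, hR]
    exact ⟨fun h => ⟨h.1.1, h.2⟩, fun h => ⟨⟨h.1, x, hx, h.2⟩, h.2⟩⟩
  have hr' : ∀ y ∈ B.shadow, #((cubeSlice n k).filter fun x => R x y) ≤ n - k + 1 := by
    intro y hy
    have := ((mem_shadow_iff_of_sized hk hB).1 hy).1
    exact (card_filter_superset_cubeSlice hk (mem_cubeSlice.1 this) hkn).le
  obtain ⟨T, hTB, hTh, hT⟩ := exists_sparse_cover R hne hr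
    (fun y hy => (card_le_card (filter_subset_filter _ hB)).trans (hr' y hy)) h
  have hTs : T ⊆ cubeSlice n k := hTB.trans hB
  have hunc : ∀ inst : DecidablePred fun y => ∀ x ∈ T, ¬ R x y,
      @Finset.filter _ (fun y => ∀ x ∈ T, ¬ R x y) inst B.shadow = B.shadow \ T.shadow := by
    intro _
    ext y
    simp only [mem_filter, mem_sdiff, mem_shadow_iff_of_sized hk hB,
      mem_shadow_iff_of_sized hk hTs, hR]
    grind
  rw [hunc] at hT
  have h1 := card_sdiff_halfNeighbours_le (A' := T.shadow) R hB hr hr'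
  have h2 := card_halfNeighbours_sdiff_le R hB (shadow_mono hTB) hr hr'
  have hch := choose_pred_mul hk hkn
  have hN : (0 : ℝ) < n.choose k := by exact_mod_cast Nat.choose_pos hkn
  have hN1 : (0 : ℝ) < n.choose (k - 1) := by exact_mod_cast Nat.choose_pos (by omega)
  have hkR : (0 : ℝ) < k := by exact_mod_cast hk
  have h1R : (k : ℝ) * #(B \ halfNeighbours (cubeSlice n k) T.shadow R k) ≤
      2 * ((n - k + 1 : ℕ) * #(B.shadow \ T.shadow)) := by exact_mod_cast h1
  set r' : ℝ := ((n - k + 1 : ℕ) : ℝ) with hr'def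
  have hr'0 : 0 ≤ r' := Nat.cast_nonneg _
  have eA : r' * #B.shadow = n.choose k * k * sliceDensity n (k - 1) B.shadow := by
    rw [← hch, sliceDensity]; field_simp
  have ed : ∀ C, (k : ℝ) * #C = n.choose k * k * sliceDensity n k C := by
    intro C; rw [sliceDensity]; field_simp
  have hW : (0 : ℝ) < n.choose k * k := by positivity
  rw [eA, ed] at hT
  rw [ed] at h1R
  rw [ed, ed, eA] at h2
  have ha0 := sliceDensity_nonneg n (k - 1) B.shadow
  refine ⟨T, hTs, hTh, ?_, ?_⟩
  · refine le_of_mul_le_mul_left ?_ hW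
    have := mul_le_mul_of_nonneg_left hκ
      (by positivity : 0 ≤ n.choose k * k * sliceDensity n (k - 1) B.shadow)
    linarith
  · refine le_of_mul_le_mul_left ?_ hW
    linarith

/-- Approximation of an upper shadow, determined by few points. -/
theorem exists_upShadow_approx {n k : ℕ} (hk : 0 < k) (hkn : k ≤ n) {B : Finset (Cube n)}
    (hB : B ⊆ cubeSlice n (k - 1)) (hne : B.Nonempty) (h : ℕ) {κ : ℝ}
    (hκ : Real.exp (-(h * ((k : ℕ) / (2 * #B)))) ≤ κ) :
    ∃ T ⊆ B, #T ≤ h ∧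
      sliceDensity n k (B.upShadow \ T.upShadow) ≤
        2 * (sliceDensity n k B.upShadow - sliceDensity n (k - 1) B) +
          κ * sliceDensity n k B.upShadow := by
  set R : Cube n → Cube n → Prop := fun x y => x ⊆ y with hR
  have hr : ∀ x ∈ B, #(B.upShadow.filter fun y => R x y) = n - k + 1 := by
    intro x hx
    rw [← card_filter_superset_cubeSlice hk (mem_cubeSlice.1 (hB hx)) hkn]
    congr 1
    ext y
    simp only [mem_filter, mem_upShadow_iff_of_sized hk hB, hR]
    exact ⟨fun h => ⟨h.1.1, h.2⟩, fun h => ⟨⟨h.1, x, hx, h.2⟩, h.2⟩⟩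
  have hr' : ∀ y ∈ B.upShadow, #(B.filter fun x => R x y) ≤ k := by
    intro y hy
    have := ((mem_upShadow_iff_of_sized hk hB).1 hy).1
    exact (card_le_card (filter_subset_filter _ hB)).trans
      (card_filter_subset_cubeSlice hk (mem_cubeSlice.1 this)).le
  obtain ⟨T, hTB, hTh, hT⟩ := exists_sparse_cover R hne hr hr' h
  have hTs : T ⊆ cubeSlice n (k - 1) := hTB.trans hB
  have hunc : ∀ inst : DecidablePred fun y => ∀ x ∈ T, ¬ R x y,
      @Finset.filter _ (fun y => ∀ x ∈ T, ¬ R x y) inst B.upShadow = B.upShadow \ T.upShadow := by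
    intro _
    ext y
    simp only [mem_filter, mem_sdiff, mem_upShadow_iff_of_sized hk hB,
      mem_upShadow_iff_of_sized hk hTs, hR]
    grind
  rw [hunc] at hT
  have hch := choose_pred_mul hk hkn
  have hN : (0 : ℝ) < n.choose k := by exact_mod_cast Nat.choose_pos hkn
  have hN1 : (0 : ℝ) < n.choose (k - 1) := by exact_mod_cast Nat.choose_pos (by omega)
  have hkR : (0 : ℝ) < k := by exact_mod_cast hk
  set r' : ℝ := ((n - k + 1 : ℕ) : ℝ) with hr'def
  have eA : r' * #B = n.choose k * k * sliceDensity n (k - 1) B := by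
    rw [← hch, sliceDensity]; field_simp
  have ed : ∀ C, (k : ℝ) * #C = n.choose k * k * sliceDensity n k C := by
    intro C; rw [sliceDensity]; field_simp
  have hW : (0 : ℝ) < n.choose k * k := by positivity
  rw [eA, ed, ed] at hT
  have ha0 := sliceDensity_nonneg n k B.upShadow
  refine ⟨T, hTB, hTh, le_of_mul_le_mul_left ?_ hW⟩
  have := mul_le_mul_of_nonneg_left hκ
    (by positivity : 0 ≤ n.choose k * k * sliceDensity n k B.upShadow)
  linarith

/-! ### Balanced sets satisfy Hall's condition -/

/-- The allowed deviation of `|S ∩ F|` from its mean, for sets `F` of size about `m`. -/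
noncomputable def deviation (n k t m : ℕ) : ℝ :=
  (t : ℝ) ^ 2 * -Real.log (m / n.choose k) * m / (16 * n)

/-- The sizes at which expansion alone does not give Hall's condition. -/
def RelevantSize (n k t m : ℕ) : Prop :=
  0 < m ∧ 2 * m ≤ n.choose k ∧ -Real.log (m / n.choose k) < 4 * n / (t : ℝ) ^ 2

/-- The container for sets in the slice of weight `k` generated by `T`. -/
def shadowContainer (n k : ℕ) (T : Finset (Cube n)) : Finset (Cube n) :=
  halfNeighbours (cubeSlice n k) T.shadow (fun x y => y ⊆ x) k

/-- `S` behaves like a set of density `ρ` on all containers of size about `m`. -/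
def BalancedAtScale (n k t m : ℕ) (q ρ : ℝ) (S : Finset (Cube n)) : Prop :=
  (∀ T ⊆ cubeSlice n k, #T ≤ ⌈q * m⌉₊ → #(shadowContainer n k T) ≤ 2 * m →
    (#(S ∩ shadowContainer n k T) : ℝ) < ρ * #(shadowContainer n k T) + deviation n k t m) ∧
  (∀ T ⊆ cubeSlice n (k - 1), #T ≤ ⌈q * m⌉₊ → #T.upShadow ≤ 2 * m →
    ρ * #T.upShadow < #(S ∩ T.upShadow) + deviation n k t m)

/-- `S` behaves like a set of density `ρ` on all containers of relevant sizes. -/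
def BalancedOnContainers (n k t : ℕ) (q ρ : ℝ) (S : Finset (Cube n)) : Prop :=
  ∀ m, RelevantSize n k t m → BalancedAtScale n k t m q ρ S

theorem card_inter_le_add_sdiff {α : Type*} [DecidableEq α] (S B F : Finset α) :
    #(S ∩ B) ≤ #(S ∩ F) + #(B \ F) := by
  refine (card_le_card fun x hx => ?_).trans (card_union_le _ _)
  simp only [mem_inter, mem_union, mem_sdiff] at hx ⊢
  tauto

/-- The gain `t (a - b)` absorbs three errors: the deviation takes at most half of it, the container
errors `6 (a - b)` at most a quarter because `t ≥ 24`, and the `κ` term at most another quarter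
because `L ≥ 0.69`. -/
theorem lower_error_bound {t n L κ b a a1 ρ sB sF f dBF dFB lam : ℝ} (hn : 0 < n) (ht : 24 ≤ t)
    (hL : 0.69 ≤ L) (hb : 0 ≤ b) (hρ0 : 0 ≤ ρ) (hρ1 : ρ ≤ 1) (hκ0 : 0 ≤ κ)
    (hκ : κ ≤ t ^ 2 / (200 * n))
    (hgap : t * L / (8 * n) * b ≤ a - b) (ha : a ≤ 1.1 * b) (ha1 : a1 ≤ a)
    (hlam : lam = t ^ 2 * L * b / (16 * n))
    (h1 : sB ≤ sF + dBF) (h2 : f ≤ b + dFB) (h3 : sF ≤ ρ * f + lam)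
    (h4 : dBF ≤ 4 * (a1 - b) + 2 * κ * a1) (h5 : dFB ≤ 2 * (a1 - b)) :
    t * b + sB ≤ (t + ρ) * a := by
  have hu : 0 ≤ t ^ 2 / n * b := by positivity
  have ht0 : 0 < t := by linarith
  have hG : L * (t ^ 2 / n * b) / 8 ≤ t * (a - b) := by
    have := mul_le_mul_of_nonneg_left hgap ht0.le
    have e : t * (t * L / (8 * n) * b) = L * (t ^ 2 / n * b) / 8 := by field_simp
    linarith
  have hG0 : 0 ≤ a - b := le_trans (by positivity) hgap
  have hlam' : lam = L * (t ^ 2 / n * b) / 16 := by rw [hlam]; field_simp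
  have hκa : 2 * κ * a1 ≤ 0.011 * (t ^ 2 / n * b) := by
    have h6 : κ * a1 ≤ κ * (1.1 * b) := mul_le_mul_of_nonneg_left (by linarith) hκ0
    have h7 : κ * (1.1 * b) ≤ t ^ 2 / (200 * n) * (1.1 * b) :=
      mul_le_mul_of_nonneg_right hκ (by positivity)
    have e : t ^ 2 / (200 * n) * (1.1 * b) = 0.0055 * (t ^ 2 / n * b) := by field_simp; ring
    linarith
  have hLu : 0.69 * (t ^ 2 / n * b) ≤ L * (t ^ 2 / n * b) := mul_le_mul_of_nonneg_right hL hu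
  have h8 : ρ * f ≤ ρ * b + 2 * (a - b) := by
    have h9 := mul_le_mul_of_nonneg_left (h2.trans (add_le_add_right h5 _)) hρ0
    have h10 : ρ * (2 * (a1 - b)) ≤ 2 * (a - b) := by nlinarith
    linarith
  have h11 : ρ * b ≤ ρ * a := mul_le_mul_of_nonneg_left (by linarith) hρ0
  have h12 : 24 * (a - b) ≤ t * (a - b) := mul_le_mul_of_nonneg_right ht hG0
  linarith

/-- The same budget as in `lower_error_bound`. The container now lies inside the set, so only one
approximation error, `2 (d - e1) + κ d`, occurs. -/
theorem upper_error_bound {t n L κ e d e1 ρ sD sF f dDF lam : ℝ} (hn : 0 < n) (ht : 24 ≤ t)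
    (hL : 0.69 ≤ L) (hd : 0 ≤ d) (hρ0 : 0 ≤ ρ) (hρ1 : ρ ≤ 1) (hκ : κ ≤ t ^ 2 / (200 * n))
    (hgap : t * L / (8 * n) * d ≤ d - e) (he1 : e ≤ e1) (hlam : lam = t ^ 2 * L * d / (16 * n))
    (h1 : sF ≤ sD) (h2 : d ≤ f + dDF) (h3 : ρ * f ≤ sF + lam) (h4 : 0 ≤ dDF)
    (h5 : dDF ≤ 2 * (d - e1) + κ * d) :
    (t + ρ) * e ≤ t * d + sD := by
  have hu : 0 ≤ t ^ 2 / n * d := by positivity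
  have ht0 : 0 < t := by linarith
  have hG : L * (t ^ 2 / n * d) / 8 ≤ t * (d - e) := by
    have := mul_le_mul_of_nonneg_left hgap ht0.le
    have e' : t * (t * L / (8 * n) * d) = L * (t ^ 2 / n * d) / 8 := by field_simp
    linarith
  have hG0 : 0 ≤ d - e := le_trans (by positivity) hgap
  have hlam' : lam = L * (t ^ 2 / n * d) / 16 := by rw [hlam]; field_simp
  have hκd : κ * d ≤ 0.005 * (t ^ 2 / n * d) := by
    have h7 : κ * d ≤ t ^ 2 / (200 * n) * d := mul_le_mul_of_nonneg_right hκ hd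
    have e' : t ^ 2 / (200 * n) * d = 0.005 * (t ^ 2 / n * d) := by field_simp; ring
    linarith
  have hLu : 0.69 * (t ^ 2 / n * d) ≤ L * (t ^ 2 / n * d) := mul_le_mul_of_nonneg_right hL hu
  have h8 : ρ * d ≤ ρ * f + dDF := by
    have h9 := mul_le_mul_of_nonneg_left h2 hρ0
    have h10 : ρ * dDF ≤ dDF := mul_le_of_le_one_left h4 hρ1
    linarith
  have h11 : ρ * e ≤ ρ * d := mul_le_mul_of_nonneg_left (by linarith) hρ0
  have h12 : 24 * (d - e) ≤ t * (d - e) := mul_le_mul_of_nonneg_right ht hG0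
  linarith

theorem neg_log_ge_of_le_half {v : ℝ} (hv : 0 < v) (hv2 : v ≤ 1 / 2) : 0.69 ≤ -Real.log v := by
  have h := Real.log_le_log hv hv2
  rw [one_div, Real.log_inv] at h
  have := Real.log_two_gt_d9
  linarith

theorem shadow_hall_of_balanced {n k t : ℕ} {q ρ : ℝ} {S : Finset (Cube n)}
    (hk : (k : ℝ) ≤ 0.55 * n) (htk : 0.45 * n ≤ (k : ℝ) - t) (hn : 0 < n) (ht : 24 ≤ t)
    (hq : 0 ≤ q) (hρ0 : 0 ≤ ρ) (hρ1 : ρ ≤ 1)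
    (hκ : Real.exp (-(q * n / 10)) ≤ (t : ℝ) ^ 2 / (200 * n))
    (hbal : BalancedOnContainers n k t q ρ S) {B : Finset (Cube n)} (hB : B ⊆ cubeSlice n k)
    (hhalf : 2 * #B ≤ n.choose k) :
    t * sliceDensity n k B + #(S ∩ B) / n.choose k ≤
      (t + ρ) * sliceDensity n (k - t) (shadow^[t] B) := by
  have hnR : (0 : ℝ) < n := by exact_mod_cast hn
  have htR : (24 : ℝ) ≤ t := by exact_mod_cast ht
  have hkR : (k : ℝ) < n := by linarith
  have hkn : k < n := by exact_mod_cast hkR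
  have htkN : t < k := by
    have : (t : ℝ) < k := by linarith
    exact_mod_cast this
  have hN : (0 : ℝ) < n.choose k := by exact_mod_cast Nat.choose_pos hkn.le
  have ha0 := sliceDensity_nonneg n (k - t) (shadow^[t] B)
  rcases B.eq_empty_or_nonempty with rfl | hne
  · have h1 : sliceDensity n k ∅ = 0 := by simp [sliceDensity]
    rw [h1]
    simp only [inter_empty, card_empty, mul_zero, Nat.cast_zero, zero_div, add_zero]
    positivity
  have hmpos : 0 < #B := hne.card_pos
  have hmR : (0 : ℝ) < #B := by exact_mod_cast hmpos
  set f : ℕ → ℝ := fun i => sliceDensity n (k - i) (shadow^[i] B) with hf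
  have hsz := sized_of_subset_cubeSlice hB
  have hf1 : ∀ i ≤ t, f i ≤ 1 := fun i _ =>
    sliceDensity_le_one (subset_cubeSlice_of_sized hsz.shadow_iterate)
  have hstep : ∀ i < t, ∀ j : ℝ, 0 ≤ j → j ≤ 0.15 * n → f (i + 1) ≤ Real.exp (-(2 * j)) →
      f i ≤ (1 - j / n) * f (i + 1) := fun i hi j hj hj2 h =>
    shadow_iterate_step (by omega) hk hsz hj hj2 h
  have hmono := chain_mono hf1 hstep
  have hf0 : f 0 = (#B : ℝ) / n.choose k := rfl
  have hb : 0 < f 0 := by rw [hf0]; exact div_pos hmR hN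
  have hb2 : f 0 ≤ 1 / 2 := by
    rw [hf0, div_le_div_iff₀ hN (by norm_num)]
    have : (2 * #B : ℝ) ≤ n.choose k := by exact_mod_cast hhalf
    linarith
  change t * f 0 + _ ≤ (t + ρ) * f t
  have hSB : (#(S ∩ B) : ℝ) / n.choose k ≤ f 0 := by
    rw [hf0]
    gcongr
    exact inter_subset_right
  -- With gain at least `1 + 1/t` the surplus `t (f t - f 0)` is at least `f 0`, which exceeds
  -- whatever `S` can add.
  rcases le_or_gt (f 0 * (1 + 1 / t)) (f t) with hbig | hsmall
  · have h1 : (t : ℝ) * (f 0 * (1 + 1 / t)) = t * f 0 + f 0 := by field_simp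
    have h2 := mul_le_mul_of_nonneg_left hbig (by positivity : (0 : ℝ) ≤ t)
    have h3 : 0 ≤ ρ * f t := mul_nonneg hρ0 ha0
    linarith
  obtain ⟨hL4, hgap⟩ := gap_of_chain hn (by linarith) hb hb2 le_rfl
    (hmono 0 t (by omega) le_rfl) (fun j hj hj2 h => chain_expansion hf1 hstep hj hj2 h) hsmall
  have hL := neg_log_ge_of_le_half hb hb2
  have hrel : RelevantSize n k t #B := ⟨hmpos, hhalf, by rw [← hf0]; exact hL4⟩
  have hat : f t ≤ 1.1 * f 0 := by
    have h1t : 1 / (t : ℝ) ≤ 0.1 := by rw [div_le_iff₀ (by linarith)]; linarith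
    nlinarith
  -- The container uses only the first shadow, and by monotonicity its gap is at most the gap over
  -- all `t` levels.
  have ha1 : f 1 ≤ f t := hmono 1 t (by omega) le_rfl
  have hexp : Real.exp (-((⌈q * #B⌉₊ : ℕ) * ((n - k + 1 : ℕ) / (2 * #B)))) ≤
      Real.exp (-(q * n / 10)) := by
    apply Real.exp_le_exp.2
    rw [neg_le_neg_iff]
    have h1 : q * #B ≤ (⌈q * #B⌉₊ : ℕ) := Nat.le_ceil _
    have h2 : 0.45 * (n : ℝ) ≤ ((n - k + 1 : ℕ) : ℝ) := by
      push_cast [Nat.cast_sub hkn.le]; linarith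
    calc q * n / 10 ≤ q * (0.45 * n) / 2 := by nlinarith [mul_nonneg hq hnR.le]
      _ ≤ q * ((n - k + 1 : ℕ) : ℝ) / 2 := by gcongr
      _ = (q * #B) * ((n - k + 1 : ℕ) / (2 * #B)) := by field_simp
      _ ≤ _ := mul_le_mul_of_nonneg_right h1 (by positivity)
  obtain ⟨T, hTs, hTh, h4, h5⟩ := exists_shadow_approx (by omega) hkn.le hB hne _ hexp
  change sliceDensity n k (B \ shadowContainer n k T) ≤ 4 * (f 1 - f 0) + 2 * _ * f 1 at h4
  change sliceDensity n k (shadowContainer n k T \ B) ≤ 2 * (f 1 - f 0) at h5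
  have h2 : sliceDensity n k (shadowContainer n k T) ≤
      f 0 + sliceDensity n k (shadowContainer n k T \ B) := by
    rw [hf0, sliceDensity, sliceDensity, ← add_div]
    gcongr
    have := card_le_card_sdiff_add_card (t := B) (s := shadowContainer n k T)
    rw [add_comm]
    exact_mod_cast this
  have hF2 : #(shadowContainer n k T) ≤ 2 * #B := by
    have h6 : sliceDensity n k (shadowContainer n k T) ≤ 2 * f 0 := by linarith
    rw [hf0, sliceDensity, ← mul_div_assoc, div_le_div_iff_of_pos_right hN] at h6
    exact_mod_cast h6
  have hlt := (hbal _ hrel).1 T hTs hTh hF2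
  refine lower_error_bound (L := -Real.log (f 0)) (sF := #(S ∩ shadowContainer n k T) / n.choose k)
    (lam := deviation n k t #B / n.choose k) hnR htR hL hb.le hρ0 hρ1 (Real.exp_nonneg _) hκ hgap hat
    ha1 ?_ ?_ h2 ?_ h4 h5
  · rw [deviation, hf0]; field_simp
  · rw [sliceDensity, ← add_div]
    gcongr
    exact_mod_cast card_inter_le_add_sdiff _ _ _
  · rw [sliceDensity, ← mul_div_assoc, ← add_div]
    gcongr

/-- Complementing the points turns upper shadows into lower shadows and preserves densities. -/
theorem upShadow_iterate_step {n l i : ℕ} (hin : l + i + 1 < n) (hl : 0.45 * n ≤ (l : ℝ) + i + 1)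
    {E : Finset (Cube n)} (hE : (E : Set (Cube n)).Sized l) {j : ℝ} (hj : 0 ≤ j)
    (hj2 : j ≤ 0.15 * n)
    (h : sliceDensity n (l + (i + 1)) (upShadow^[i + 1] E) ≤ Real.exp (-(2 * j))) :
    sliceDensity n (l + i) (upShadow^[i] E) ≤
      (1 - j / n) * sliceDensity n (l + (i + 1)) (upShadow^[i + 1] E) := by
  have hcompl : ∀ i' (_ : l + i' ≤ n), sliceDensity n (l + i') (upShadow^[i'] E) =
      sliceDensity n (n - (l + i')) (upShadow^[i'] E).compls := by
    intro i' hi'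
    rw [sliceDensity, sliceDensity, card_compls, Nat.choose_symm hi']
  have hszu : ∀ i', ((upShadow^[i'] E).compls : Set (Cube n)).Sized (n - (l + i')) := by
    intro i' x hx
    rw [mem_coe, mem_compls] at hx
    obtain ⟨u, hu, _, hc⟩ := mem_upShadow_iterate_iff_exists_mem_card_add.1 hx
    have h1 := hE hu
    rw [card_compl, Fintype.card_fin] at hc
    have h2 : #x ≤ n := by simpa using card_le_univ x
    omega
  rw [hcompl _ (by omega), hcompl _ (by omega)] at *
  have e : n - (l + i) = n - (l + (i + 1)) + 1 := by omega
  have hi := hszu i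
  have hi1 := hszu (i + 1)
  rw [e] at hi ⊢
  refine sliceDensity_le_of_shadow_subset hj hj2 (by omega) ?_ hi1 hi ?_ h
  · rw [Nat.cast_sub (by omega)]
    push_cast
    linarith
  · rw [Function.iterate_succ_apply', ← shadow_compls]
    exact erase_mem_shadow_of_mem _

/-- The counterpart of `shadow_hall_of_balanced` for upper shadows: the relevant density is that of
the last member of the chain, and the container comes from the last step, from slice `k - 1` to
slice `k`. -/
theorem upShadow_hall_of_balanced {n k t : ℕ} {q ρ : ℝ} {S : Finset (Cube n)}
    (hk : (k : ℝ) ≤ 0.55 * n) (htk : 0.45 * n ≤ (k : ℝ) - t) (hn : 0 < n) (ht : 24 ≤ t)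
    (hq : 0 ≤ q) (hρ0 : 0 ≤ ρ) (hρ1 : ρ ≤ 1)
    (hκ : Real.exp (-(q * n / 10)) ≤ (t : ℝ) ^ 2 / (200 * n))
    (hbal : BalancedOnContainers n k t q ρ S) {E : Finset (Cube n)} (hE : E ⊆ cubeSlice n (k - t))
    (hhalf : 2 * #(upShadow^[t] E) ≤ n.choose k) :
    (t + ρ) * sliceDensity n (k - t) E ≤
      t * sliceDensity n k (upShadow^[t] E) + #(S ∩ upShadow^[t] E) / n.choose k := by
  have hnR : (0 : ℝ) < n := by exact_mod_cast hn
  have htR : (24 : ℝ) ≤ t := by exact_mod_cast ht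
  have hkR : (k : ℝ) < n := by linarith
  have hkn : k < n := by exact_mod_cast hkR
  have htkN : t < k := by
    have : (t : ℝ) < k := by linarith
    exact_mod_cast this
  have hN : (0 : ℝ) < n.choose k := by exact_mod_cast Nat.choose_pos hkn.le
  set D := upShadow^[t] E with hD
  rcases E.eq_empty_or_nonempty with rfl | hne
  · have h1 : sliceDensity n (k - t) ∅ = 0 := by simp [sliceDensity]
    have h2 := sliceDensity_nonneg n k D
    rw [h1, mul_zero]
    positivity
  set g : ℕ → ℝ := fun i => sliceDensity n (k - t + i) (upShadow^[i] E) with hg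
  have hsz := sized_of_subset_cubeSlice hE
  have hslice : ∀ i, upShadow^[i] E ⊆ cubeSlice n (k - t + i) := by
    intro i x hx
    obtain ⟨u, hu, _, hc⟩ := mem_upShadow_iterate_iff_exists_mem_card_add.1 hx
    rw [mem_cubeSlice, hc, hsz hu]
  have hg1 : ∀ i ≤ t, g i ≤ 1 := fun i _ => sliceDensity_le_one (hslice i)
  have hkt : ((k - t : ℕ) : ℝ) = k - t := Nat.cast_sub htkN.le
  have hstep : ∀ i < t, ∀ j : ℝ, 0 ≤ j → j ≤ 0.15 * n → g (i + 1) ≤ Real.exp (-(2 * j)) →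
      g i ≤ (1 - j / n) * g (i + 1) := fun i hi j hj hj2 h =>
    upShadow_iterate_step (by omega)
      (by rw [hkt]; have : (0 : ℝ) ≤ i := Nat.cast_nonneg _; linarith) hsz hj hj2 h
  have hmono := chain_mono hg1 hstep
  have hgt : g t = (#D : ℝ) / n.choose k := by
    simp only [hg, sliceDensity, ← hD]
    rw [Nat.sub_add_cancel htkN.le]
  have hgD : sliceDensity n k D = g t := by rw [hgt, sliceDensity]
  have hg0 : 0 < g 0 := by
    have h1 : (0 : ℝ) < #E := by exact_mod_cast hne.card_pos
    have h2 : (0 : ℝ) < n.choose (k - t) := by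
      exact_mod_cast Nat.choose_pos ((Nat.sub_le _ _).trans hkn.le)
    exact div_pos h1 h2
  have hd : 0 < g t := hg0.trans_le (hmono 0 t (by omega) le_rfl)
  have hmR : (0 : ℝ) < #D := by
    rw [hgt] at hd
    exact (div_pos_iff_of_pos_right hN).1 hd
  have hmpos : 0 < #D := by exact_mod_cast hmR
  have hd2 : g t ≤ 1 / 2 := by
    rw [hgt, div_le_div_iff₀ hN (by norm_num)]
    have : (2 * #D : ℝ) ≤ n.choose k := by exact_mod_cast hhalf
    linarith
  rw [hgD]
  change (t + ρ) * g 0 ≤ _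
  rcases le_or_gt (g 0 * (1 + 1 / t)) (g t) with hbig | hsmall
  · have h1 : (t : ℝ) * (g 0 * (1 + 1 / t)) = t * g 0 + g 0 := by field_simp
    have h2 := mul_le_mul_of_nonneg_left hbig (by positivity : (0 : ℝ) ≤ t)
    have h3 : ρ * g 0 ≤ g 0 := mul_le_of_le_one_left hg0.le hρ1
    have h4 : (0 : ℝ) ≤ #(S ∩ D) / n.choose k := by positivity
    linarith
  obtain ⟨hL4, hgap⟩ := gap_of_chain hn (by linarith) hd hd2 (hmono 0 t (by omega) le_rfl)
    le_rfl (fun j hj hj2 h => chain_expansion hg1 hstep hj hj2 h) hsmall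
  have hL := neg_log_ge_of_le_half hd hd2
  have hrel : RelevantSize n k t #D := ⟨hmpos, hhalf, by rw [← hgt]; exact hL4⟩
  set E' := upShadow^[t - 1] E with hE'
  have hE's : E' ⊆ cubeSlice n (k - 1) := by
    have := hslice (t - 1)
    rwa [show k - t + (t - 1) = k - 1 by omega] at this
  have hDE : E'.upShadow = D := by
    rw [hD, hE', ← Function.iterate_succ_apply' upShadow, show (t - 1).succ = t by omega]
  have hgE : g (t - 1) = sliceDensity n (k - 1) E' := by
    simp only [hg, ← hE']
    rw [show k - t + (t - 1) = k - 1 by omega]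
  have he1 : g (t - 1) ≤ g t := hmono _ _ (by omega) le_rfl
  have he0 : g 0 ≤ g (t - 1) := hmono _ _ (by omega) (by omega)
  have hE'pos : (0 : ℝ) < #E' := by
    have h1 : (0 : ℝ) < n.choose (k - 1) := by
      exact_mod_cast Nat.choose_pos ((Nat.sub_le _ _).trans hkn.le)
    have := hg0.trans_le he0
    rw [hgE, sliceDensity] at this
    exact (div_pos_iff_of_pos_right h1).1 this
  have hE'ne : E'.Nonempty := card_pos.1 (by exact_mod_cast hE'pos)
  have hnk : 0.45 * (n : ℝ) ≤ ((n - k + 1 : ℕ) : ℝ) := by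
    push_cast [Nat.cast_sub hkn.le]; linarith
  -- The number of generators is measured by `#D` but the cover is taken inside `E'`; this factor
  -- `2` is what leaves `0.45 / 4 ≥ 1 / 10` in `hexp`.
  have hE'card : (#E' : ℝ) ≤ 2 * #D := by
    have hch := choose_pred_mul (by omega : 0 < k) hkn.le
    have h1 : (0 : ℝ) < n.choose (k - 1) := by
      exact_mod_cast Nat.choose_pos ((Nat.sub_le _ _).trans hkn.le)
    rw [hgE, hgt, sliceDensity, div_le_div_iff₀ h1 hN] at he1
    have h2 : (#E' : ℝ) * (n.choose k * k) ≤ 2 * #D * (n.choose k * k) := by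
      have h3 : (k : ℝ) ≤ 2 * ((n - k + 1 : ℕ) : ℝ) := by linarith
      calc (#E' : ℝ) * (n.choose k * k) = #E' * n.choose k * k := by ring
        _ ≤ #D * n.choose (k - 1) * k := by gcongr
        _ ≤ #D * n.choose (k - 1) * (2 * ((n - k + 1 : ℕ) : ℝ)) := by gcongr
        _ = 2 * #D * (n.choose (k - 1) * ((n - k + 1 : ℕ) : ℝ)) := by ring
        _ = _ := by rw [hch]
    have hk0 : (0 : ℝ) < k := by have : 0 < k := by omega
                                 exact_mod_cast this
    exact le_of_mul_le_mul_right h2 (by positivity)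
  have hexp : Real.exp (-((⌈q * #D⌉₊ : ℕ) * ((k : ℕ) / (2 * #E')))) ≤
      Real.exp (-(q * n / 10)) := by
    apply Real.exp_le_exp.2
    rw [neg_le_neg_iff]
    have h1 : q * #D ≤ (⌈q * #D⌉₊ : ℕ) := Nat.le_ceil _
    have h2 : 0.45 * (n : ℝ) ≤ k := by linarith
    calc q * n / 10 ≤ q * (0.45 * n) / 4 := by nlinarith [mul_nonneg hq hnR.le]
      _ ≤ q * k / 4 := by gcongr
      _ = (q * #D) * (k / (2 * (2 * #D))) := by field_simp; norm_num
      _ ≤ (q * #D) * (k / (2 * #E')) := by gcongr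
      _ ≤ _ := mul_le_mul_of_nonneg_right h1 (by positivity)
  obtain ⟨T, hTs, hTh, h5⟩ := exists_upShadow_approx (by omega) hkn.le hE's hE'ne _ hexp
  rw [hDE, hgD, ← hgE] at h5
  have hTD : T.upShadow ⊆ D := by rw [← hDE]; exact upShadow_monotone hTs
  have hlt := (hbal _ hrel).2 T (hTs.trans hE's) hTh ((card_le_card hTD).trans (by omega))
  refine upper_error_bound (L := -Real.log (g t)) (e1 := g (t - 1))
    (sF := #(S ∩ T.upShadow) / n.choose k) (f := sliceDensity n k T.upShadow)
    (lam := deviation n k t #D / n.choose k) hnR htR hL hd.le hρ0 hρ1 hκ hgap he0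
    ?_ ?_ ?_ ?_ (sliceDensity_nonneg n k _) h5
  · rw [deviation, hgt]; field_simp
  · gcongr
  · rw [hgt, sliceDensity, sliceDensity, ← add_div]
    gcongr
    have := card_le_card_sdiff_add_card (t := T.upShadow) (s := D)
    rw [add_comm]
    exact_mod_cast this
  · rw [sliceDensity, ← mul_div_assoc, ← add_div]
    gcongr

/-- Balanced sets satisfy the matching property with the lower slice. -/
theorem matching_of_balanced {n k s t : ℕ} {q : ℝ} {S : Finset (Cube n)}
    (hk : (k : ℝ) ≤ 0.55 * n) (htk : 0.45 * n ≤ (k : ℝ) - t) (hn : 0 < n) (ht : 24 ≤ t)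
    (hq : 0 ≤ q) (hκ : Real.exp (-(q * n / 10)) ≤ (t : ℝ) ^ 2 / (200 * n))
    (hS : S ⊆ cubeSlice n k) (hs : #S = s)
    (hbal : BalancedOnContainers n k t q (s / n.choose k) S) :
    MonotoneFractionalMatching
      (((t : ℝ≥0) + (s : ℝ≥0) / (n.choose k : ℝ≥0)) • sliceMeasure n (k - t))
      ((t : ℝ≥0) • sliceMeasure n k + subsetMeasure n k S) := by
  have hnR : (0 : ℝ) < n := by exact_mod_cast hn
  have htR : (24 : ℝ) ≤ t := by exact_mod_cast ht
  have hkR : (k : ℝ) < n := by linarith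
  have hkn : k < n := by exact_mod_cast hkR
  have htkN : t < k := by
    have : (t : ℝ) < k := by linarith
    exact_mod_cast this
  have hNnat := Nat.choose_pos hkn.le
  have hN : (0 : ℝ) < n.choose k := by exact_mod_cast hNnat
  have hsN : s ≤ n.choose k := by rw [← hs, ← card_cubeSlice]; exact card_le_card hS
  have hρ0 : (0 : ℝ) ≤ s / n.choose k := by positivity
  have hρ1 : (s : ℝ) / n.choose k ≤ 1 := div_le_one_of_le₀ (by exact_mod_cast hsN) hN.le
  refine matching_of_upShadow_bound htkN.le hkn.le hS hs fun E hE => ?_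
  rcases le_or_gt (2 * #(upShadow^[t] E)) (n.choose k) with hhalf | hhalf
  · exact upShadow_hall_of_balanced hk htk hn ht hq hρ0 hρ1 hκ hbal hE hhalf
  set D := upShadow^[t] E with hD
  have hDs : D ⊆ cubeSlice n k := by
    intro x hx
    obtain ⟨u, hu, _, hc⟩ := mem_upShadow_iterate_iff_exists_mem_card_add.1 hx
    have := mem_cubeSlice.1 (hE hu)
    rw [mem_cubeSlice]
    omega
  have hBcard : #(cubeSlice n k \ D) + #D = n.choose k := by
    rw [card_sdiff_add_card_eq_card hDs, card_cubeSlice]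
  -- Since `D` exceeds half of the slice, the inequality is proved for its complement and
  -- transferred back: the shadow of the complement is disjoint from `E`, so their densities sum to
  -- at most `1`.
  have h := shadow_hall_of_balanced hk htk hn ht hq hρ0 hρ1 hκ hbal
    (B := cubeSlice n k \ D) sdiff_subset (by omega)
  set B := cubeSlice n k \ D with hB
  have hdisj : Disjoint (shadow^[t] B) E := by
    rw [disjoint_left]
    intro y hy hyE
    obtain ⟨x, hx, hyx, hc⟩ := mem_shadow_iterate_iff_exists_mem_card_add.1 hy
    rw [hB, mem_sdiff] at hx
    exact hx.2 (mem_upShadow_iterate_iff_exists_mem_card_add.2 ⟨y, hyE, hyx, hc⟩)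
  have hsum : sliceDensity n (k - t) (shadow^[t] B) + sliceDensity n (k - t) E ≤ 1 := by
    have h1 : sliceDensity n (k - t) (shadow^[t] B) + sliceDensity n (k - t) E =
        sliceDensity n (k - t) (shadow^[t] B ∪ E) := by
      rw [sliceDensity, sliceDensity, sliceDensity, ← add_div, card_union_of_disjoint hdisj]
      push_cast; rfl
    rw [h1]
    refine sliceDensity_le_one (union_subset (subset_cubeSlice_of_sized ?_) hE)
    exact (sized_of_subset_cubeSlice sdiff_subset).shadow_iterate
  have hBd : sliceDensity n k B = 1 - sliceDensity n k D := by
    have h1 : (#B : ℝ) + #D = n.choose k := by exact_mod_cast hBcard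
    rw [sliceDensity, sliceDensity, eq_sub_iff_add_eq, ← add_div, h1, div_self hN.ne']
  have hSB : (#(S ∩ B) : ℝ) / n.choose k = s / n.choose k - #(S ∩ D) / n.choose k := by
    have h1 : #(S ∩ B) + #(S ∩ D) = s := by
      rw [← hs, ← card_union_of_disjoint]
      · congr 1
        ext x
        have := @hS x
        simp only [hB, mem_union, mem_inter, mem_sdiff]
        tauto
      · rw [disjoint_left]
        intro x; simp only [hB, mem_inter, mem_sdiff]; tauto
    have h2 : (#(S ∩ B) : ℝ) + #(S ∩ D) = s := by exact_mod_cast h1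
    rw [eq_sub_iff_add_eq, ← add_div, h2]
  rw [hBd, hSB] at h
  have h2 := mul_le_mul_of_nonneg_left hsum (by positivity : (0 : ℝ) ≤ t + s / n.choose k)
  linarith

/-! ### Union bound over containers -/

open Classical in
theorem card_exists_upper_tail_le {α ι : Type*} [DecidableEq α] {X : Finset α}
    (I : Finset ι) (F : ι → Finset α) (hF : ∀ i ∈ I, F i ⊆ X) {s : ℕ} (hs : s ≤ #X) {θ r f : ℝ}
    (hθ : 0 ≤ θ) (hθ1 : θ ≤ 1) (hf : ∀ i ∈ I, (#(F i) : ℝ) ≤ f) :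
    (#((powersetCard s X).filter
      fun S => ∃ i ∈ I, (s : ℝ) / #X * #(F i) + r ≤ #(S ∩ F i)) : ℝ) ≤
      (#X).choose s * (#I * Real.exp (θ ^ 2 * f - θ * r)) := by
  have hsub : (powersetCard s X).filter
      (fun S => ∃ i ∈ I, (s : ℝ) / #X * #(F i) + r ≤ #(S ∩ F i)) ⊆
      I.biUnion fun i => (powersetCard s X).filter
        fun S => (s : ℝ) / #X * #(F i) + r ≤ #(S ∩ F i) := by
    intro S hS
    simp only [mem_filter, mem_biUnion] at hS ⊢
    obtain ⟨h1, i, hi, h2⟩ := hS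
    exact ⟨i, hi, h1, h2⟩
  have h1 := (card_le_card hsub).trans card_biUnion_le
  have h2 : (#((powersetCard s X).filter
      fun S => ∃ i ∈ I, (s : ℝ) / #X * #(F i) + r ≤ #(S ∩ F i)) : ℝ) ≤
      ∑ i ∈ I, (#((powersetCard s X).filter
        fun S => (s : ℝ) / #X * #(F i) + r ≤ #(S ∩ F i)) : ℝ) := by exact_mod_cast h1
  refine h2.trans ((sum_le_card_nsmul _ _ ((#X).choose s * Real.exp (θ ^ 2 * f - θ * r))
    fun i hi => ?_).trans (le_of_eq ?_))
  · refine (card_upper_tail_le (hF i hi) hs hθ hθ1).trans ?_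
    gcongr
    exact hf i hi
  · rw [nsmul_eq_mul]; ring

open Classical in
theorem card_exists_lower_tail_le {α ι : Type*} [DecidableEq α] {X : Finset α}
    (I : Finset ι) (F : ι → Finset α) (hF : ∀ i ∈ I, F i ⊆ X) {s : ℕ} (hs : s ≤ #X) {θ r f : ℝ}
    (hθ : 0 ≤ θ) (hθ1 : θ ≤ 1) (hf : ∀ i ∈ I, (#(F i) : ℝ) ≤ f) :
    (#((powersetCard s X).filter
      fun S => ∃ i ∈ I, (#(S ∩ F i) : ℝ) + r ≤ (s : ℝ) / #X * #(F i)) : ℝ) ≤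
      (#X).choose s * (#I * Real.exp (θ ^ 2 * f - θ * r)) := by
  have hsub : (powersetCard s X).filter
      (fun S => ∃ i ∈ I, (#(S ∩ F i) : ℝ) + r ≤ (s : ℝ) / #X * #(F i)) ⊆
      I.biUnion fun i => (powersetCard s X).filter
        fun S => (#(S ∩ F i) : ℝ) + r ≤ (s : ℝ) / #X * #(F i) := by
    intro S hS
    simp only [mem_filter, mem_biUnion] at hS ⊢
    obtain ⟨h1, i, hi, h2⟩ := hS
    exact ⟨i, hi, h1, h2⟩
  have h1 := (card_le_card hsub).trans card_biUnion_le
  have h2 : (#((powersetCard s X).filter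
      fun S => ∃ i ∈ I, (#(S ∩ F i) : ℝ) + r ≤ (s : ℝ) / #X * #(F i)) : ℝ) ≤
      ∑ i ∈ I, (#((powersetCard s X).filter
        fun S => (#(S ∩ F i) : ℝ) + r ≤ (s : ℝ) / #X * #(F i)) : ℝ) := by exact_mod_cast h1
  refine h2.trans ((sum_le_card_nsmul _ _ ((#X).choose s * Real.exp (θ ^ 2 * f - θ * r))
    fun i hi => ?_).trans (le_of_eq ?_))
  · refine (card_lower_tail_le (hF i hi) hs hθ hθ1).trans ?_
    gcongr
    exact hf i hi
  · rw [nsmul_eq_mul]; ring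

/-- The number of small generating sets at scale `m`. -/
theorem card_small_subsets_le {α : Type*} [DecidableEq α] (X : Finset α) {N m : ℕ} {q : ℝ}
    (hq : 0 < q) (hq1 : q ≤ 1) (hm : m ≤ N) (hqm : 1 ≤ q * m) (hX : #X ≤ 2 * N) :
    (#(X.powerset.filter fun T => #T ≤ ⌈q * m⌉₊) : ℝ) ≤
      Real.exp (2 * q * m * (-Real.log (m / N) - Real.log q + 1)) := by
  have hm0 : (0 : ℝ) < m := by
    by_contra h
    have h1 : (m : ℝ) = 0 := le_antisymm (not_lt.1 h) (Nat.cast_nonneg _)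
    rw [h1, mul_zero] at hqm
    linarith
  have hmN : (m : ℝ) ≤ N := by exact_mod_cast hm
  have hN : (0 : ℝ) < N := hm0.trans_le hmN
  have hx : 0 < q * (m / N) := by positivity
  have hx1 : q * (m / N) ≤ 1 := mul_le_one₀ hq1 (by positivity) (div_le_one_of_le₀ hmN hN.le)
  -- The weight `q m / N` keeps the factor `exp(x #X)` down to `exp(2 q m)`. The hypothesis `1 ≤ q
  -- m` serves to absorb the rounding in the ceiling.
  refine (card_filter_card_le_le X _ hx hx1).trans ?_
  have hlog : Real.log (q * (m / N)) = Real.log q + Real.log (m / N) :=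
    Real.log_mul hq.ne' (by positivity)
  have hlog0 : Real.log (q * (m / N)) ≤ 0 := Real.log_nonpos hx.le hx1
  have hpow : ((q * (m / N))⁻¹) ^ ⌈q * m⌉₊ =
      Real.exp ((⌈q * m⌉₊ : ℕ) * -Real.log (q * (m / N))) := by
    rw [Real.exp_nat_mul, Real.exp_neg, Real.exp_log hx]
  rw [hpow, ← Real.exp_add]
  apply Real.exp_le_exp.2
  have hceil : ((⌈q * m⌉₊ : ℕ) : ℝ) ≤ 2 * q * m := by
    have := Nat.ceil_lt_add_one (by positivity : 0 ≤ q * m)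
    linarith
  have h1 : ((⌈q * m⌉₊ : ℕ) : ℝ) * -Real.log (q * (m / N)) ≤
      2 * q * m * -Real.log (q * (m / N)) :=
    mul_le_mul_of_nonneg_right hceil (by linarith)
  have h2 : q * (m / N) * #X ≤ 2 * q * m := by
    have h3 : (#X : ℝ) ≤ 2 * N := by exact_mod_cast hX
    calc q * (m / N) * #X ≤ q * (m / N) * (2 * N) := by gcongr
      _ = 2 * q * m := by field_simp
  rw [hlog] at h1 ⊢
  linarith

theorem shadowContainer_subset (n k : ℕ) (T : Finset (Cube n)) :
    shadowContainer n k T ⊆ cubeSlice n k := filter_subset _ _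

open Classical in
/-- The probability that a random set is unbalanced on some container at scale `m`. -/
theorem card_unbalanced_at_scale_le {n k s t m : ℕ} {q θ : ℝ} (hk0 : 0 < k)
    (hs : s ≤ n.choose k) (hN : n.choose (k - 1) ≤ 2 * n.choose k) (hn : 0 < n) (ht : 24 ≤ t)
    (hq : 0 < q) (hq1 : q ≤ 1) (hqm : 1 ≤ q * m) (hm : RelevantSize n k t m)
    (hθ : θ = (t : ℝ) ^ 2 * -Real.log (m / n.choose k) / (64 * n))
    (hcost : 2 * q * (-Real.log (m / n.choose k) - Real.log q + 1) ≤ θ ^ 2) :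
    (#((powersetCard s (cubeSlice n k)).filter fun S =>
      ¬ BalancedAtScale n k t m q (s / n.choose k) S) : ℝ) ≤
      (n.choose k).choose s * (2 * Real.exp (-(θ ^ 2 * m))) := by
  obtain ⟨hm0, hm2, hmL⟩ := hm
  have hnR : (0 : ℝ) < n := by exact_mod_cast hn
  have htR : (24 : ℝ) ≤ t := by exact_mod_cast ht
  have hmN : m ≤ n.choose k := by omega
  have hmR : (0 : ℝ) < m := by exact_mod_cast hm0
  have hNR : (0 : ℝ) < n.choose k := hmR.trans_le (by exact_mod_cast hmN)
  set L := -Real.log (m / n.choose k) with hL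
  have hL0 : 0 ≤ L := by
    have := Real.log_nonpos (by positivity : (0 : ℝ) ≤ m / n.choose k)
      (div_le_one_of_le₀ (by exact_mod_cast hmN) hNR.le)
    linarith
  have hθ0 : 0 ≤ θ := by rw [hθ]; positivity
  have hθ1 : θ ≤ 1 := by
    rw [hθ, div_le_one (by positivity)]
    rw [lt_div_iff₀ (by positivity)] at hmL
    linarith
  -- For sets of size at most `2m`, Chernoff's exponent is `2θ² m - 4θ² m = -2θ² m`; the count of
  -- containers costs at most `θ² m`, leaving `-θ² m`.
  have hdev : deviation n k t m = 4 * θ * m := by rw [deviation, hθ, ← hL]; ring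
  have hX := card_cubeSlice n k
  set I1 := ((cubeSlice n k).powerset.filter fun T => #T ≤ ⌈q * m⌉₊).filter
    fun T => #(shadowContainer n k T) ≤ 2 * m with hI1
  set I2 := ((cubeSlice n (k - 1)).powerset.filter fun T => #T ≤ ⌈q * m⌉₊).filter
    fun T => #T.upShadow ≤ 2 * m with hI2
  have hI1card : (#I1 : ℝ) ≤ Real.exp (2 * q * m * (L - Real.log q + 1)) := by
    refine le_trans ?_ (card_small_subsets_le (cubeSlice n k) hq hq1 hmN hqm (by omega))
    exact_mod_cast card_filter_le _ _
  have hI2card : (#I2 : ℝ) ≤ Real.exp (2 * q * m * (L - Real.log q + 1)) := by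
    refine le_trans ?_ (card_small_subsets_le (cubeSlice n (k - 1)) hq hq1 hmN hqm
      (by rw [card_cubeSlice]; exact hN))
    exact_mod_cast card_filter_le _ _
  have h1 := card_exists_upper_tail_le I1 (shadowContainer n k)
    (fun T _ => shadowContainer_subset n k T) (s := s) (by rw [hX]; exact hs)
    (r := deviation n k t m) (f := 2 * m) hθ0 hθ1
    (fun T hT => by exact_mod_cast (mem_filter.1 hT).2)
  have h2 := card_exists_lower_tail_le (X := cubeSlice n k) I2 upShadow
    (fun T hT x hx => by
      have hTs := mem_powerset.1 (mem_filter.1 (mem_filter.1 hT).1).1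
      exact ((mem_upShadow_iff_of_sized hk0 hTs).1 hx).1) (s := s) (by rw [hX]; exact hs)
    (r := deviation n k t m) (f := 2 * m) hθ0 hθ1
    (fun T hT => by exact_mod_cast (mem_filter.1 hT).2)
  rw [hX] at h1 h2
  have hexp : ∀ I : Finset (Finset (Cube n)),
      (#I : ℝ) ≤ Real.exp (2 * q * m * (L - Real.log q + 1)) →
      (#I : ℝ) * Real.exp (θ ^ 2 * (2 * m) - θ * deviation n k t m) ≤
        Real.exp (-(θ ^ 2 * m)) := by
    intro I hI
    refine (mul_le_mul_of_nonneg_right hI (Real.exp_nonneg _)).trans ?_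
    rw [← Real.exp_add, hdev]
    apply Real.exp_le_exp.2
    have := mul_le_mul_of_nonneg_right hcost hmR.le
    linarith
  have hC : (0 : ℝ) ≤ (n.choose k).choose s := Nat.cast_nonneg _
  have h1' := h1.trans (mul_le_mul_of_nonneg_left (hexp I1 hI1card) hC)
  have h2' := h2.trans (mul_le_mul_of_nonneg_left (hexp I2 hI2card) hC)
  have hsub : (powersetCard s (cubeSlice n k)).filter (fun S =>
      ¬ BalancedAtScale n k t m q (s / n.choose k) S) ⊆
      (powersetCard s (cubeSlice n k)).filter (fun S => ∃ T ∈ I1,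
        (s : ℝ) / n.choose k * #(shadowContainer n k T) + deviation n k t m ≤
          #(S ∩ shadowContainer n k T)) ∪
      (powersetCard s (cubeSlice n k)).filter (fun S => ∃ T ∈ I2,
        (#(S ∩ T.upShadow) : ℝ) + deviation n k t m ≤ (s : ℝ) / n.choose k * #T.upShadow) := by
    intro S hS
    rw [mem_filter, BalancedAtScale, not_and_or] at hS
    rw [mem_union, mem_filter, mem_filter]
    rcases hS.2 with h | h
    · push Not at h
      obtain ⟨T, hT1, hT2, hT3, hT4⟩ := h
      exact Or.inl ⟨hS.1, T, by simp only [hI1, mem_filter, mem_powerset]; exact ⟨⟨hT1, hT2⟩, hT3⟩,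
        hT4⟩
    · push Not at h
      obtain ⟨T, hT1, hT2, hT3, hT4⟩ := h
      exact Or.inr ⟨hS.1, T, by simp only [hI2, mem_filter, mem_powerset]; exact ⟨⟨hT1, hT2⟩, hT3⟩,
        hT4⟩
  have hcard := (card_le_card hsub).trans (card_union_le _ _)
  have hcardR := (Nat.cast_le (α := ℝ)).2 hcard
  rw [Nat.cast_add] at hcardR
  linarith

open Classical in
/-- The probability that a random set is unbalanced on some container. -/
theorem card_unbalanced_le {n k s t : ℕ} {q W : ℝ} (hk0 : 0 < k)
    (hs : s ≤ n.choose k) (hN : n.choose (k - 1) ≤ 2 * n.choose k) (hn : 0 < n) (ht : 24 ≤ t)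
    (hq : 0 < q) (hq1 : q ≤ 1)
    (hm : ∀ m, RelevantSize n k t m → 1 ≤ q * m ∧
      2 * q * (-Real.log (m / n.choose k) - Real.log q + 1) ≤
        ((t : ℝ) ^ 2 * -Real.log (m / n.choose k) / (64 * n)) ^ 2 ∧
      W ≤ ((t : ℝ) ^ 2 * -Real.log (m / n.choose k) / (64 * n)) ^ 2 * m) :
    (#((powersetCard s (cubeSlice n k)).filter fun S =>
      ¬ BalancedOnContainers n k t q (s / n.choose k) S) : ℝ) ≤
      (n.choose k).choose s * ((n.choose k + 1) * (2 * Real.exp (-W))) := by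
  set bad : ℕ → Finset (Finset (Cube n)) := fun m =>
    (powersetCard s (cubeSlice n k)).filter fun S =>
      ¬ BalancedAtScale n k t m q (s / n.choose k) S with hbad
  set J := (range (n.choose k + 1)).filter fun m => RelevantSize n k t m with hJ
  have hsub : (powersetCard s (cubeSlice n k)).filter (fun S =>
      ¬ BalancedOnContainers n k t q (s / n.choose k) S) ⊆ J.biUnion bad := by
    intro S hS
    rw [mem_filter, BalancedOnContainers] at hS
    obtain ⟨hS1, hS2⟩ := hS
    rw [not_forall] at hS2
    obtain ⟨m, hS2⟩ := hS2
    rw [Classical.not_imp] at hS2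
    rw [mem_biUnion]
    refine ⟨m, ?_, ?_⟩
    · rw [hJ, mem_filter, mem_range]
      exact ⟨by have := hS2.1.2.1; omega, hS2.1⟩
    · rw [hbad, mem_filter]
      exact ⟨hS1, hS2.2⟩
  have hcard := (Nat.cast_le (α := ℝ)).2 ((card_le_card hsub).trans card_biUnion_le)
  rw [Nat.cast_sum] at hcard
  refine hcard.trans ((sum_le_card_nsmul _ _ ((n.choose k).choose s * (2 * Real.exp (-W)))
    fun m hmJ => ?_).trans ?_)
  · have hrel := (mem_filter.1 hmJ).2
    obtain ⟨h1, h2, h3⟩ := hm m hrel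
    refine (card_unbalanced_at_scale_le hk0 hs hN hn ht hq hq1 h1 hrel rfl h2).trans ?_
    gcongr
  · rw [nsmul_eq_mul]
    have hJc : (#J : ℝ) ≤ n.choose k + 1 := by
      have : #J ≤ n.choose k + 1 := by simpa using card_filter_le (range (n.choose k + 1)) _
      exact_mod_cast this
    have : (0 : ℝ) ≤ (n.choose k).choose s * (2 * Real.exp (-W)) := by positivity
    calc _ ≤ ((n.choose k : ℝ) + 1) * ((n.choose k).choose s * (2 * Real.exp (-W))) :=
          mul_le_mul_of_nonneg_right hJc this
      _ = _ := by ring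

theorem one_sub_le_randomSubsetProb {n k s : ℕ} {P Q : Finset (Cube n) → Prop} {β : ℝ}
    (hs : s ≤ n.choose k)
    (hQP : ∀ S ∈ powersetCard s (cubeSlice n k), Q S → P S)
    (hbad : open Classical in (#((powersetCard s (cubeSlice n k)).filter fun S => ¬ Q S) : ℝ) ≤
      (n.choose k).choose s * β) :
    1 - β ≤ randomSubsetProb n k s P := by
  classical
  have hpos : (0 : ℝ) < (n.choose k).choose s := by exact_mod_cast Nat.choose_pos hs
  rw [randomSubsetProb, card_powersetCard, card_cubeSlice, le_div_iff₀ hpos]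
  have h1 : #((powersetCard s (cubeSlice n k)).filter Q) +
      #((powersetCard s (cubeSlice n k)).filter fun S => ¬ Q S) = (n.choose k).choose s := by
    rw [card_filter_add_card_filter_not, card_powersetCard, card_cubeSlice]
  have h2 : #((powersetCard s (cubeSlice n k)).filter Q) ≤
      #((powersetCard s (cubeSlice n k)).filter P) := by
    refine card_le_card fun S hS => ?_
    rw [mem_filter] at hS ⊢
    exact ⟨hS.1, hQP S hS.1 hS.2⟩
  have h1R : (#((powersetCard s (cubeSlice n k)).filter Q) : ℝ) +
      #((powersetCard s (cubeSlice n k)).filter fun S => ¬ Q S) = (n.choose k).choose s := by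
    exact_mod_cast h1
  have h2R : (#((powersetCard s (cubeSlice n k)).filter Q) : ℝ) ≤
      #((powersetCard s (cubeSlice n k)).filter P) := by exact_mod_cast h2
  have h3 : (#((powersetCard s (cubeSlice n k)).filter fun S => ¬ Q S) : ℝ) ≤
      (n.choose k).choose s * β := by convert hbad
  have h4 : (#((powersetCard s (cubeSlice n k)).filter P) : ℝ) =
      #(@Finset.filter _ P (fun _ => Classical.propDecidable _) (powersetCard s (cubeSlice n k))) := by
    congr!
  rw [← h4]
  linarith

/-! ### Complementation symmetry -/

theorem sum_weightSupport_compl {n : ℕ} (f : Cube n → ℝ≥0) (g : Cube n → ℝ≥0) :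
    ∑ z ∈ weightSupport (fun x => f xᶜ), g zᶜ = ∑ z ∈ weightSupport f, g z := by
  refine sum_nbij' (fun z => zᶜ) (fun z => zᶜ) ?_ ?_ ?_ ?_ ?_ <;> simp [weightSupport]

/-- Complementation reverses monotone fractional matchings. -/
theorem MonotoneFractionalMatching.compl {n : ℕ} {wU wV : Cube n → ℝ≥0}
    (h : MonotoneFractionalMatching wU wV) :
    MonotoneFractionalMatching (fun x => wV xᶜ) (fun x => wU xᶜ) := by
  obtain ⟨hsum, w, hw, hrow, hcol⟩ := h
  have hc : ∀ f : Cube n → ℝ≥0, ∑ x, f xᶜ = ∑ x, f x := fun f =>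
    sum_nbij' (fun z => zᶜ) (fun z => zᶜ) (by simp) (by simp) (by simp) (by simp) (by simp)
  refine ⟨by rw [hc, hc, hsum], fun x y => w yᶜ xᶜ, ?_, ?_, ?_⟩
  · intro u hu v hv h
    have := hw vᶜ (by simpa [weightSupport] using hv) uᶜ (by simpa [weightSupport] using hu) h
    exact compl_le_compl_iff_le.1 this
  · intro x hx
    rw [sum_weightSupport_compl wU fun z => w z xᶜ]
    exact hcol _ (by simpa [weightSupport] using hx)
  · intro y hy
    rw [sum_weightSupport_compl wV fun z => w yᶜ z]
    exact hrow _ (by simpa [weightSupport] using hy)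

theorem compl_mem_cubeSlice {n k : ℕ} (hk : k ≤ n) {x : Cube n} :
    xᶜ ∈ cubeSlice n (n - k) ↔ x ∈ cubeSlice n k := by
  have h : #x ≤ n := by simpa using card_le_univ x
  rw [mem_cubeSlice, mem_cubeSlice, card_compl, Fintype.card_fin]
  omega

theorem sliceMeasure_compl {n k : ℕ} (hk : k ≤ n) (x : Cube n) :
    sliceMeasure n (n - k) xᶜ = sliceMeasure n k x := by
  simp only [sliceMeasure, compl_mem_cubeSlice hk, card_cubeSlice, Nat.choose_symm hk]

theorem subsetMeasure_compl {n k : ℕ} (hk : k ≤ n) (S : Finset (Cube n)) (x : Cube n) :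
    subsetMeasure n (n - k) S xᶜ = subsetMeasure n k S.compls x := by
  simp only [subsetMeasure, sliceMeasure_compl hk, mem_compls]

theorem randomSubsetProb_compl_le {n k s : ℕ} (hk : k ≤ n) {P Q : Finset (Cube n) → Prop}
    (hPQ : ∀ S, P S → Q S.compls) :
    randomSubsetProb n (n - k) s P ≤ randomSubsetProb n k s Q := by
  classical
  rw [randomSubsetProb, randomSubsetProb, card_powersetCard, card_powersetCard, card_cubeSlice,
    card_cubeSlice, Nat.choose_symm hk]
  gcongr ?_ / _
  norm_cast
  refine card_le_card_of_injOn (fun S => S.compls) ?_ fun S _ T _ h => by simpa using congrArg compls h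
  intro S hS
  simp only [coe_filter, mem_powersetCard, Set.mem_ofPred_eq] at hS ⊢
  refine ⟨⟨fun x hx => ?_, by rw [card_compls, hS.1.2]⟩, hPQ S hS.2⟩
  exact (compl_mem_cubeSlice hk).1 (hS.1.1 (mem_compls.1 hx))

theorem randomSubsetProb_upper_ge {n k s t : ℕ} (ρ : ℝ≥0) (hkt : k + t ≤ n) :
    randomSubsetProb n (n - k) s (fun S =>
      MonotoneFractionalMatching
        (((t : ℝ≥0) + ρ) • sliceMeasure n (n - k - t))
        ((t : ℝ≥0) • sliceMeasure n (n - k) + subsetMeasure n (n - k) S)) ≤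
    randomSubsetProb n k s (fun S =>
      MonotoneFractionalMatching
        ((t : ℝ≥0) • sliceMeasure n k + subsetMeasure n k S)
        (((t : ℝ≥0) + ρ) • sliceMeasure n (k + t))) := by
  have hk : k ≤ n := by omega
  refine randomSubsetProb_compl_le hk fun S h => ?_
  have h' := h.compl
  convert h' using 1
  · funext x
    simp only [Pi.add_apply, Pi.smul_apply, sliceMeasure_compl hk, subsetMeasure_compl hk]
  · funext x
    simp only [Pi.smul_apply]
    rw [Nat.sub_sub, sliceMeasure_compl hkt]

/-! ### Choice of parameters and asymptotic estimates -/

/-- Middle binomial coefficients are large. -/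
theorem two_rpow_le_mul_choose {n k : ℕ} (hn : 20 ≤ n) (h1 : 0.45 * n ≤ (k : ℝ))
    (h2 : (k : ℝ) ≤ 0.55 * n) : (2 : ℝ) ^ (0.9 * n : ℝ) ≤ n * n.choose k := by
  -- Below the middle, `4 ^ r ≤ r * (2r).choose r ≤ n * n.choose r`; the other half follows by
  -- symmetry.
  have key : ∀ r : ℕ, 0.45 * n ≤ (r : ℝ) → 2 * r ≤ n →
      (2 : ℝ) ^ (0.9 * n : ℝ) ≤ n * n.choose r := by
    intro r hr hrn
    have hn' : (20 : ℝ) ≤ n := by exact_mod_cast hn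
    have hr4 : 4 ≤ r := by
      have : (4 : ℝ) ≤ r := by linarith
      exact_mod_cast this
    have h3 := (Nat.four_pow_lt_mul_centralBinom r hr4).le
    have h4 : r * r.centralBinom ≤ n * n.choose r := by
      rw [Nat.centralBinom_eq_two_mul_choose]
      exact Nat.mul_le_mul (by omega) (Nat.choose_le_choose r hrn)
    have h5 : ((4 ^ r : ℕ) : ℝ) ≤ (n * n.choose r : ℕ) := by exact_mod_cast h3.trans h4
    push_cast at h5
    refine le_trans ?_ h5
    have e : (4 : ℝ) ^ r = (2 : ℝ) ^ (2 * r : ℝ) := by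
      rw [Real.rpow_mul (by norm_num), Real.rpow_natCast]; norm_num
    rw [e]
    exact Real.rpow_le_rpow_of_exponent_le (by norm_num) (by linarith)
  have hkn : k ≤ n := by
    have hn' : (0 : ℝ) ≤ n := Nat.cast_nonneg _
    have : (k : ℝ) ≤ n := by linarith
    exact_mod_cast this
  rcases le_or_gt (2 * k) n with h | h
  · exact key k h1 h
  · rw [← Nat.choose_symm hkn]
    refine key (n - k) ?_ (by omega)
    rw [Nat.cast_sub hkn]
    linarith

/-- The largeness conditions on `y = n ^ (1 / 6)` used in the union bound. -/
structure SufficientlyLarge (y : ℝ) : Prop where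
  ge : 20 ≤ y
  log_le : 10 * Real.log y + 2 ≤ 0.5 * y
  sq_le : 2 * y ^ 2 ≤ Real.exp (y / 10)
  pow_le : y ^ 11 ≤ Real.exp y

theorem eventually_sufficientlyLarge : ∀ᶠ y in Filter.atTop, SufficientlyLarge y := by
  have h1 := (isLittleO_pow_exp_pos_mul_atTop 3 (b := 1 / 10) (by norm_num)).bound one_pos
  have h2 := (isLittleO_pow_exp_pos_mul_atTop 11 (b := 1) one_pos).bound one_pos
  have h3 := Real.isLittleO_log_id_atTop.bound (c := 0.04) (by norm_num)
  filter_upwards [h1, h2, h3, Filter.eventually_ge_atTop 20] with y h1 h2 h3 h4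
  have hy : 0 ≤ y := by linarith
  have hlog : 0 ≤ Real.log y := Real.log_nonneg (by linarith)
  simp only [id, Real.norm_eq_abs, abs_pow, Real.abs_exp, abs_of_nonneg hy, one_mul,
    abs_of_nonneg hlog] at h1 h2 h3
  refine ⟨h4, by linarith, ?_, h2⟩
  rw [show (1 / 10) * y = y / 10 by ring] at h1
  nlinarith [sq_nonneg y]

/-- With `y = n ^ (1/6)` and `t ≥ 10 y²`, `θ` is at least `1.5 L / y²`. So `θ²` is of order at least
`L² / y⁴`, while the container cost is of order `(L + log y) / y⁵`. -/
theorem cost_bound {y t n q L : ℝ} (hy : SufficientlyLarge y) (hn : n = y ^ 6)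
    (hq : q = (y ^ 5)⁻¹) (ht : 10 * y ^ 2 ≤ t) (hL : 0.69 ≤ L) :
    (y ^ 4)⁻¹ ≤ (t ^ 2 * L / (64 * n)) ^ 2 ∧
      2 * q * (L - Real.log q + 1) ≤ (t ^ 2 * L / (64 * n)) ^ 2 := by
  have hy20 := hy.ge
  have hy0 : 0 < y := by linarith
  have hlogq : Real.log q = -(5 * Real.log y) := by
    rw [hq, Real.log_inv, Real.log_pow]; norm_num
  have ht2 : 100 * y ^ 4 ≤ t ^ 2 := by
    have := pow_le_pow_left₀ (by positivity) ht 2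
    linarith [this, (by ring : (10 * y ^ 2) ^ 2 = 100 * y ^ 4)]
  have hθ : 1.5 * L * (y ^ 2)⁻¹ ≤ t ^ 2 * L / (64 * n) := by
    rw [hn, le_div_iff₀ (by positivity)]
    have e : 1.5 * L * (y ^ 2)⁻¹ * (64 * y ^ 6) = 96 * y ^ 4 * L := by field_simp; ring
    rw [e]
    have : 96 * y ^ 4 ≤ t ^ 2 := by linarith [(by positivity : 0 ≤ y ^ 4)]
    exact mul_le_mul_of_nonneg_right this (by linarith)
  have hθ2 := pow_le_pow_left₀ (by positivity) hθ 2
  have e2 : (1.5 * L * (y ^ 2)⁻¹) ^ 2 = 2.25 * L ^ 2 * (y ^ 4)⁻¹ := by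
    rw [mul_pow, mul_pow, inv_pow, ← pow_mul]; norm_num
  rw [e2] at hθ2
  have hL2 : 0.69 * L ≤ L ^ 2 := by nlinarith
  constructor
  · refine le_trans ?_ hθ2
    have : (0 : ℝ) ≤ (y ^ 4)⁻¹ := by positivity
    have h1 : 1 ≤ 2.25 * L ^ 2 := by nlinarith
    linarith [mul_le_mul_of_nonneg_right h1 this]
  · refine le_trans ?_ hθ2
    have e3 : 2 * q * (L - Real.log q + 1) = 2 * (L + 5 * Real.log y + 1) * y⁻¹ * (y ^ 4)⁻¹ := by
      rw [hlogq, hq]; field_simp; ring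
    rw [e3]
    refine mul_le_mul_of_nonneg_right ?_ (by positivity)
    rw [← div_eq_mul_inv, div_le_iff₀ hy0]
    have h1 := hy.log_le
    have h2 := mul_le_mul_of_nonneg_right hL2 hy0.le
    have h3 := mul_le_mul_of_nonneg_right hL hy0.le
    have h4 := mul_le_mul_of_nonneg_left hy20 (by linarith : 0 ≤ L)
    nlinarith

/-- The factor `y ^ 11` is `n = y ^ 6` times `y ^ 5`; together with `exp(y² / 25)` it is far below
`2 ^ (0.2 n)`, since `n = y ^ 6`. -/
theorem scale_bound {y : ℝ} {n N : ℕ} (hy : SufficientlyLarge y) (hn : (n : ℝ) = y ^ 6)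
    (hN : (2 : ℝ) ^ (0.9 * n : ℝ) ≤ n * N) :
    (2 : ℝ) ^ (0.7 * n : ℝ) ≤ N * Real.exp (-(y ^ 2 / 25)) * (y ^ 5)⁻¹ := by
  have hy20 := hy.ge
  have hy0 : 0 < y := by linarith
  have hn0 : (0 : ℝ) < n := by rw [hn]; positivity
  have h1 : y ^ 11 * Real.exp (y ^ 2 / 25) ≤ (2 : ℝ) ^ (0.2 * n : ℝ) := by
    refine (mul_le_mul_of_nonneg_right hy.pow_le (Real.exp_nonneg _)).trans ?_
    rw [← Real.exp_add, Real.rpow_def_of_pos (by norm_num)]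
    apply Real.exp_le_exp.2
    have hlog := Real.log_two_gt_d9
    have h3 : 20 * y ≤ y ^ 2 := by nlinarith
    have h4 : (20 : ℝ) ^ 4 * y ^ 2 ≤ y ^ 6 := by
      have := pow_le_pow_left₀ (by norm_num) hy20 4
      calc _ ≤ y ^ 4 * y ^ 2 := mul_le_mul_of_nonneg_right this (by positivity)
        _ = _ := by ring
    rw [hn]
    have h5 : 0.69 * (0.2 * y ^ 6) ≤ Real.log 2 * (0.2 * y ^ 6) :=
      mul_le_mul_of_nonneg_right (by linarith) (by positivity)
    have h6 : 0 ≤ y ^ 2 := by positivity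
    linarith
  have h2 : (2 : ℝ) ^ (0.7 * n : ℝ) * (y ^ 11 * Real.exp (y ^ 2 / 25)) ≤ n * N := by
    refine (mul_le_mul_of_nonneg_left h1 (by positivity)).trans (le_trans (le_of_eq ?_) hN)
    rw [← Real.rpow_add (by norm_num)]
    congr 1
    ring
  generalize (2 : ℝ) ^ (0.7 * n : ℝ) = Z at h2 ⊢
  rw [hn] at h2
  rw [Real.exp_neg, mul_assoc, ← mul_inv, ← div_eq_mul_inv, le_div_iff₀ (by positivity)]
  refine le_of_mul_le_mul_left ?_ (by positivity : 0 < y ^ 6)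
  calc _ = Z * (y ^ 11 * Real.exp (y ^ 2 / 25)) := by ring
    _ ≤ _ := h2

theorem failure_bound {y W : ℝ} {n N : ℕ} (hy : SufficientlyLarge y) (hn : (n : ℝ) = y ^ 6)
    (hN : N ≤ 2 ^ n) (hW : (2 : ℝ) ^ (0.7 * n : ℝ) ≤ W) :
    ((N : ℝ) + 1) * (2 * Real.exp (-W)) ≤ (2 : ℝ) ^ (-(1 * (2 : ℝ) ^ ((n : ℝ) / 2))) := by
  have hy20 := hy.ge
  have hy0 : 0 < y := by linarith
  have hlog := Real.log_two_gt_d9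
  have hlog' := Real.log_two_lt_d9
  have hn20 : (20 : ℝ) ≤ n := by
    rw [hn]
    have := pow_le_pow_left₀ (by norm_num) hy20 6
    linarith
  have h2n : (1 : ℝ) ≤ 2 ^ n := one_le_pow₀ (by norm_num)
  have hNR : (N : ℝ) ≤ 2 ^ n := by exact_mod_cast hN
  have h1 : ((N : ℝ) + 1) * 2 ≤ Real.exp (Real.log 2 * (n + 2)) := by
    rw [← Real.rpow_def_of_pos (by norm_num), Real.rpow_add (by norm_num), Real.rpow_natCast]
    norm_num
    linarith
  have h2 : (n : ℝ) + 2 ≤ (2 : ℝ) ^ ((n : ℝ) / 2) := by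
    rw [Real.rpow_def_of_pos (by norm_num)]
    have h3 := Real.quadratic_le_exp_of_nonneg (x := Real.log 2 * (n / 2)) (by positivity)
    have h4 : 0.3 * (n : ℝ) ≤ Real.log 2 * (n / 2) := by nlinarith
    have h5 := pow_le_pow_left₀ (by positivity) h4 2
    nlinarith
  have h3 : 2 * (2 : ℝ) ^ ((n : ℝ) / 2) ≤ (2 : ℝ) ^ (0.7 * n : ℝ) := by
    have : (2 : ℝ) * (2 : ℝ) ^ ((n : ℝ) / 2) = (2 : ℝ) ^ (1 + (n : ℝ) / 2) := by
      rw [Real.rpow_add (by norm_num), Real.rpow_one]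
    rw [this]
    exact Real.rpow_le_rpow_of_exponent_le (by norm_num) (by linarith)
  calc ((N : ℝ) + 1) * (2 * Real.exp (-W)) = (((N : ℝ) + 1) * 2) * Real.exp (-W) := by ring
    _ ≤ Real.exp (Real.log 2 * (n + 2)) * Real.exp (-W) :=
        mul_le_mul_of_nonneg_right h1 (Real.exp_nonneg _)
    _ = Real.exp (Real.log 2 * (n + 2) - W) := by rw [← Real.exp_add]; rfl
    _ ≤ _ := by
        rw [Real.rpow_def_of_pos (by norm_num)]
        apply Real.exp_le_exp.2
        nlinarith [Real.rpow_nonneg (by norm_num : (0 : ℝ) ≤ 2) ((n : ℝ) / 2)]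

/-- The matching with the lower slice exists with overwhelming probability. -/
theorem randomSubsetProb_lower_ge {n k s t : ℕ} {y : ℝ} (hy : SufficientlyLarge y)
    (hn : (n : ℝ) = y ^ 6) (hk : (k : ℝ) ≤ 0.55 * n) (htk : 0.45 * n ≤ (k : ℝ) - t)
    (ht : 10 * y ^ 2 ≤ t) (hs : s ≤ n.choose k) :
    1 - (2 : ℝ) ^ (-(1 * (2 : ℝ) ^ ((n : ℝ) / 2))) ≤
      randomSubsetProb n k s (fun S =>
        MonotoneFractionalMatching
          (((t : ℝ≥0) + (s : ℝ≥0) / (n.choose k : ℝ≥0)) • sliceMeasure n (k - t))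
          ((t : ℝ≥0) • sliceMeasure n k + subsetMeasure n k S)) := by
  have hy20 := hy.ge
  have hy0 : 0 < y := by linarith
  have hn0R : (0 : ℝ) < n := by rw [hn]; positivity
  have hn0 : 0 < n := by exact_mod_cast hn0R
  have hn20R : (20 : ℝ) ≤ n := by
    rw [hn]
    have := pow_le_pow_left₀ (by norm_num) hy20 6
    linarith
  have hn20 : 20 ≤ n := by exact_mod_cast hn20R
  have ht24R : (24 : ℝ) ≤ t := by nlinarith
  have ht24 : 24 ≤ t := by exact_mod_cast ht24R
  have hkn : k ≤ n := by
    have : (k : ℝ) ≤ n := by linarith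
    exact_mod_cast this
  have hk0R : (0 : ℝ) < k := by linarith
  have hk0 : 0 < k := by exact_mod_cast hk0R
  have ht2 : 100 * y ^ 4 ≤ (t : ℝ) ^ 2 := by
    have := pow_le_pow_left₀ (by positivity) ht 2
    linarith [this, (by ring : (10 * y ^ 2) ^ 2 = 100 * y ^ 4)]
  -- Then `q n = y`, so the uncovered fraction `exp(-y / 10)` is below `t² / (200 n)`, while `q`
  -- stays small enough for `cost_bound`.
  set q : ℝ := (y ^ 5)⁻¹ with hq
  have hq0 : 0 < q := by positivity
  have hq1 : q ≤ 1 := inv_le_one_of_one_le₀ (one_le_pow₀ (by linarith))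
  have hκ : Real.exp (-(q * n / 10)) ≤ (t : ℝ) ^ 2 / (200 * n) := by
    have e : q * n / 10 = y / 10 := by rw [hq, hn]; field_simp
    rw [e, Real.exp_neg, le_div_iff₀ (by positivity), inv_mul_le_iff₀ (Real.exp_pos _), hn]
    calc 200 * y ^ 6 = 2 * y ^ 2 * (100 * y ^ 4) := by ring
      _ ≤ Real.exp (y / 10) * t ^ 2 := mul_le_mul hy.sq_le ht2 (by positivity) (by positivity)
  have hN : n.choose (k - 1) ≤ 2 * n.choose k := by
    have hch := choose_pred_mul hk0 hkn
    have h1 : (k : ℝ) ≤ 2 * ((n - k + 1 : ℕ) : ℝ) := by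
      push_cast [Nat.cast_sub hkn]; linarith
    have h2 : (0 : ℝ) < ((n - k + 1 : ℕ) : ℝ) := by positivity
    have h3 : (n.choose (k - 1) : ℝ) ≤ 2 * n.choose k := by
      refine le_of_mul_le_mul_right ?_ h2
      rw [hch]
      nlinarith [mul_le_mul_of_nonneg_left h1 (Nat.cast_nonneg (α := ℝ) (n.choose k))]
    exact_mod_cast h3
  have hNR : (0 : ℝ) < n.choose k := by exact_mod_cast Nat.choose_pos hkn
  have htR0 : (0 : ℝ) ≤ t := Nat.cast_nonneg _
  have hscale := scale_bound hy hn (two_rpow_le_mul_choose hn20 (by linarith) hk)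
  set W : ℝ := n.choose k * Real.exp (-(y ^ 2 / 25)) * (y ^ 4)⁻¹ with hW
  have hWge : (n.choose k : ℝ) * Real.exp (-(y ^ 2 / 25)) * (y ^ 5)⁻¹ ≤ W := by
    rw [hW]
    gcongr ?_ * ?_
    apply inv_anti₀ (by positivity)
    exact pow_le_pow_right₀ (by linarith) (by norm_num)
  have hmain : ∀ m, RelevantSize n k t m → 1 ≤ q * m ∧
      2 * q * (-Real.log (m / n.choose k) - Real.log q + 1) ≤
        ((t : ℝ) ^ 2 * -Real.log (m / n.choose k) / (64 * n)) ^ 2 ∧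
      W ≤ ((t : ℝ) ^ 2 * -Real.log (m / n.choose k) / (64 * n)) ^ 2 * m := by
    intro m hm
    obtain ⟨hm0, hm2, hmL⟩ := hm
    have hmR : (0 : ℝ) < m := by exact_mod_cast hm0
    have hv : (0 : ℝ) < m / n.choose k := by positivity
    have hv2 : (m : ℝ) / n.choose k ≤ 1 / 2 := by
      rw [div_le_div_iff₀ hNR (by norm_num)]
      have : (2 * m : ℝ) ≤ n.choose k := by exact_mod_cast hm2
      linarith
    have hL := neg_log_ge_of_le_half hv hv2
    obtain ⟨h1, h2⟩ := cost_bound hy hn hq ht hL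
    -- Relevance gives `L < 4n / t² ≤ 4 y⁶ / (100 y⁴) = y² / 25`.
    have hL2 : -Real.log (m / n.choose k) ≤ y ^ 2 / 25 := by
      refine hmL.le.trans ?_
      rw [div_le_iff₀ (by positivity), hn]
      nlinarith [mul_le_mul_of_nonneg_left ht2 (by positivity : 0 ≤ y ^ 2 / 25)]
    have hmge : n.choose k * Real.exp (-(y ^ 2 / 25)) ≤ m := by
      have h3 : Real.exp (-(y ^ 2 / 25)) ≤ m / n.choose k := by
        rw [← Real.exp_log hv]
        exact Real.exp_le_exp.2 (by linarith)
      rw [le_div_iff₀ hNR] at h3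
      linarith
    refine ⟨?_, h2, ?_⟩
    · have h4 : (1 : ℝ) ≤ (2 : ℝ) ^ (0.7 * n : ℝ) :=
        Real.one_le_rpow (by norm_num) (by positivity)
      have h5 := mul_le_mul_of_nonneg_right hmge hq0.le
      linarith
    · rw [hW, mul_comm]
      exact mul_le_mul h1 hmge (by positivity) (by positivity)
  have hbad := card_unbalanced_le hk0 hs hN hn0 ht24 hq0 hq1 hmain
  have hfail := failure_bound hy hn (Nat.choose_le_two_pow n k) (hscale.trans hWge)
  refine one_sub_le_randomSubsetProb hs
    (Q := BalancedOnContainers n k t q (s / n.choose k)) (fun S hS hbal => ?_)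
    (hbad.trans (mul_le_mul_of_nonneg_left hfail (Nat.cast_nonneg _)))
  rw [mem_powersetCard] at hS
  exact matching_of_balanced hk htk hn0 ht24 hq0.le hκ hS.1 hS.2 hbal

theorem eventually_sqrt_mul_log_le {C : ℝ} (hC : 0 < C) :
    ∀ᶠ n : ℕ in Filter.atTop, C * Real.sqrt (n * Real.log n) ≤ 0.02 * n := by
  have h := (Real.isLittleO_log_id_atTop.comp_tendsto tendsto_natCast_atTop_atTop).bound
    (c := (0.02 / C) ^ 2) (by positivity)
  filter_upwards [h, Filter.eventually_ge_atTop 1] with n hn h1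
  have h1R : (1 : ℝ) ≤ n := by exact_mod_cast h1
  have hlog := Real.log_nonneg h1R
  simp only [Function.comp, id, Real.norm_eq_abs, abs_of_nonneg hlog, Nat.abs_cast] at hn
  have h2 : Real.sqrt (n * Real.log n) ≤ 0.02 / C * n := by
    apply Real.sqrt_le_iff.2
    refine ⟨by positivity, ?_⟩
    have := mul_le_mul_of_nonneg_left hn (Nat.cast_nonneg (α := ℝ) n)
    linarith
  calc C * Real.sqrt (n * Real.log n) ≤ C * (0.02 / C * n) := mul_le_mul_of_nonneg_left h2 hC.le
    _ = _ := by field_simp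

theorem mainTheorem6 :
    ∃ c : ℝ, 0 < c ∧ ∀ C : ℝ, 0 < C → ∃ n₀ : ℕ, ∀ n : ℕ, n₀ ≤ n → ∀ k s t : ℕ,
      (n : ℝ) / 2 - C * Real.sqrt (n * Real.log n) ≤ (k : ℝ) →
      (k : ℝ) ≤ (n : ℝ) / 2 + C * Real.sqrt (n * Real.log n) →
      10 * (n : ℝ) ^ ((1 : ℝ) / 3) ≤ (t : ℝ) →
      (t : ℝ) ≤ C * Real.sqrt (n * Real.log n) →
      s ≤ n.choose k →
      ∀ ρ : ℝ≥0, ρ = (s : ℝ≥0) / (n.choose k : ℝ≥0) →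
        t ≤ k ∧ k + t ≤ n ∧
        1 - (2 : ℝ) ^ (-(c * (2 : ℝ) ^ ((n : ℝ) / 2))) ≤
          randomSubsetProb n k s (fun S =>
            MonotoneFractionalMatching
              (((t : ℝ≥0) + ρ) • sliceMeasure n (k - t))
              ((t : ℝ≥0) • sliceMeasure n k + subsetMeasure n k S)) ∧
        1 - (2 : ℝ) ^ (-(c * (2 : ℝ) ^ ((n : ℝ) / 2))) ≤
          randomSubsetProb n k s (fun S =>
            MonotoneFractionalMatching
              ((t : ℝ≥0) • sliceMeasure n k + subsetMeasure n k S)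
              (((t : ℝ≥0) + ρ) • sliceMeasure n (k + t))) := by
  refine ⟨1, one_pos, fun C hC => ?_⟩
  have hlarge : ∀ᶠ n : ℕ in Filter.atTop, SufficientlyLarge ((n : ℝ) ^ ((1 : ℝ) / 6)) :=
    ((tendsto_rpow_atTop (by norm_num : (0 : ℝ) < 1 / 6)).comp
      tendsto_natCast_atTop_atTop).eventually eventually_sufficientlyLarge
  -- With `C √(n log n) ≤ 0.02 n`, both `k` and `n - k` lie within `0.02 n` of `n / 2` and `t ≤ 0.02
  -- n`, so the bounds `0.45 n` and `0.55 n` hold with room to spare.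
  obtain ⟨n₀, hn₀⟩ := Filter.eventually_atTop.1
    (hlarge.and (eventually_sqrt_mul_log_le hC))
  refine ⟨n₀, fun n hn k s t hk1 hk2 ht1 ht2 hs ρ hρ => ?_⟩
  obtain ⟨hy, hsqrt⟩ := hn₀ n hn
  have hnn : (0 : ℝ) ≤ n := Nat.cast_nonneg _
  have hny : (n : ℝ) = ((n : ℝ) ^ ((1 : ℝ) / 6)) ^ 6 := by
    rw [← Real.rpow_mul_natCast hnn]; norm_num
  have hty : 10 * ((n : ℝ) ^ ((1 : ℝ) / 6)) ^ 2 ≤ t := by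
    rw [← Real.rpow_mul_natCast hnn]
    norm_num at ht1 ⊢
    exact ht1
  have htk : t ≤ k := by
    have : (t : ℝ) ≤ k := by linarith
    exact_mod_cast this
  have hkt : k + t ≤ n := by
    have : (k : ℝ) + t ≤ n := by linarith
    exact_mod_cast this
  have hkn : k ≤ n := by omega
  subst hρ
  refine ⟨htk, hkt, ?_, ?_⟩
  · exact randomSubsetProb_lower_ge hy hny (by linarith) (by linarith) hty hs
  · refine le_trans ?_ (randomSubsetProb_upper_ge _ hkt)
    have hnk : ((n - k : ℕ) : ℝ) = n - k := Nat.cast_sub hkn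
    have h := randomSubsetProb_lower_ge (k := n - k) (s := s) hy hny (by rw [hnk]; linarith)
      (by rw [hnk]; linarith) hty (by rwa [Nat.choose_symm hkn])
    rwa [Nat.choose_symm hkn] at h
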